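/- Let $k$ be an algebraically closed field of characteristic $p>0$ and let $G$ be a finite group of order $p^n$. An affine variety over $k$ is a reduced affine $k$-scheme of finite type (not necessarily irreducible); $G$ acts on varieties by $k$-automorphisms, and the action is free if no $g\neq 1$ fixes a closed point. For an affine variety $Y$ with $G$-action, $Y/G$ denotes the spectrum of the ring of invariants $k[Y]^G$. Let $D=k[X_g : g\in G]/(\sum_{g\in G} X_g-1)$ with the $G$-action $g X_h=X_{gh}$. Call a $G$-stable subalgebra $U\subseteq D$ *standard* if: - $U$ is trace-surjective, i.e. every element of $U^G$ is of the form $\sum_{g\in G} g(a)$ with $a\in U$; - $U=k[t_1,\dots,t_n]$ is a polynomial ring in $n$ variables with triangular action, i.e. for all $g\in G$ and all $i$ one has $g(t_i)-t_i\in k[t_1,\dots,t_{i-1}]$; - $U^G$ is isomorphic as a $k$-algebra to a polynomial ring over $k$ in $n$ variables; - $D=U\oplus I$ for some $G$-stable ideal $I$ of $D$. Then standard subalgebras exist. Let $X$ be an arbitrary affine variety over $k$. 1. There is an affine variety $Y$ with free $G$-action such that $Y/G\cong X$. Moreover, for every standard $U\subseteq D$, with $\mathbf B=\operatorname{Spec}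 U$ and its induced $G$-action, and for every affine variety $Y$ with free $G$-action and every isomorphism $Y/G\cong X$: 2. There are a morphism $X\to\mathbf B/G$ and a $G$-equivariant morphism $Y\to\mathbf B$ which, together with the quotient maps $Y\to Y/G\cong X$ and $\mathbf B\to\mathbf B/G$, exhibit $Y$ as the fibre product $X\times_{\mathbf B/G}\mathbf B$. 3. If $G\neq 1$, there is a $G$-equivariant closed embedding $Y\hookrightarrow\mathbf B^N$ for some $N\in\mathbb N$, where $G$ acts diagonally on $\mathbf B^N$. -/

import Mathlib

open CategoryTheory CategoryTheory.Limits AlgebraicGeometry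

universe u

noncomputable section

namespace FreeAction

/-! ### Algebras with a group action

A `k-G` algebra is given by a commutative `k`-algebra `R` and a homomorphism from `G` to the monoid
of `k`-algebra endomorphisms of `R` (left action; since `G` is a group, it acts by automorphisms). -/

section Algebra

variable {k : Type u} [Field k] {G : Type u} [Group G]
variable {R : Type u} [CommRing R] [Algebra k R]

/-- The ring of invariants `R^G`. -/
def invariants (σ : G →* (R →ₐ[k] R)) : Subalgebra k R where
  carrier := {r | ∀ g, σ g r = r}
  mul_mem' ha hb g := by rw [map_mul, ha g, hb g]
  add_mem' ha hb g := by rw [map_add, ha g, hb g]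
  algebraMap_mem' r g := (σ g).commutes r

/-- The trace map `R → R`, `a ↦ ∑ g, g a` has image the full ring of invariants `R^G`
(its image is always contained in `R^G`). -/
def IsTraceSurjective [Fintype G] (σ : G →* (R →ₐ[k] R)) : Prop :=
  ∀ r ∈ invariants σ, ∃ a : R, ∑ g, σ g a = r

/-- `R` is a polynomial ring in `n` generators `t₀, …, tₙ₋₁` with respect to which the action is
triangular: `g tᵢ = tᵢ + f_{g,i}(t₀, …, tᵢ₋₁)`. -/
def IsTriangular (n : ℕ) (σ : G →* (R →ₐ[k] R)) : Prop :=
  ∃ e : MvPolynomial (Fin n) k ≃ₐ[k] R, ∀ (g : G) (i : Fin n),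
    ∃ f ∈ MvPolynomial.supported k {j : Fin n | j < i},
      σ g (e (MvPolynomial.X i)) = e (MvPolynomial.X i) + e f

/-- A subalgebra is `G`-stable. -/
def IsStable (σ : G →* (R →ₐ[k] R)) (U : Subalgebra k R) : Prop :=
  ∀ g, ∀ r ∈ U, σ g r ∈ U

/-- The action on a `G`-stable subalgebra. -/
def restrictAction (σ : G →* (R →ₐ[k] R)) (U : Subalgebra k R) (hU : IsStable σ U) :
    G →* (U →ₐ[k] U) where
  toFun g := ((σ g).comp U.val).codRestrict U fun r => hU g r r.2
  map_one' := by ext r; simp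
  map_mul' g h := by
    ext r
    change σ (g * h) r = σ g (σ h r)
    rw [map_mul]
    rfl

variable (k G) [Fintype G]

/-- The dehomogenized symmetric algebra of the (dual of the) regular representation:
the polynomial ring in variables `X_g`, `g ∈ G`, modulo `∑ g, X_g = 1`. -/
abbrev Dehom : Type u :=
  MvPolynomial G k ⧸ Ideal.span {(∑ g : G, MvPolynomial.X g - 1 : MvPolynomial G k)}

/-- The action of `G` on `Dehom k G`, given by `g X_h = X_{gh}`. -/
def dehomAction : G →* (Dehom k G →ₐ[k] Dehom k G) where
  toFun g := Ideal.quotientMapₐ _ (MvPolynomial.rename (g * ·)) (by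
    rw [Ideal.span_singleton_le_iff_mem, Ideal.mem_comap]
    have : (MvPolynomial.rename (g * ·)) (∑ g : G, MvPolynomial.X g - 1 : MvPolynomial G k)
        = ∑ g : G, MvPolynomial.X g - 1 := by
      simp only [map_sub, map_sum, MvPolynomial.rename_X, map_one]
      congr 1
      exact Equiv.sum_comp (Equiv.mulLeft g) (fun h => (MvPolynomial.X h : MvPolynomial G k))
    change (MvPolynomial.rename (g * ·)) _ ∈ _
    rw [this]
    exact Ideal.mem_span_singleton_self _)
  map_one' := by
    apply Ideal.Quotient.algHom_ext
    ext h
    simp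
  map_mul' g h := by
    apply Ideal.Quotient.algHom_ext
    ext x
    simp [mul_assoc]

variable {k G}

/-- The `G`-stable subalgebras `U` of `D = Dehom k G` whose spectrum is the variety `B`:
`U` is trace-surjective, a polynomial ring in `n` variables with triangular action, with polynomial
ring of invariants `U^G` in `n` variables, and a `G`-equivariant retract of `D`,
i.e. `D = U ⊕ I` for a `G`-stable ideal `I`. -/
structure IsStandard (n : ℕ) (U : Subalgebra k (Dehom k G)) : Prop where
  stable : IsStable (dehomAction k G) U
  traceSurjective : IsTraceSurjective (restrictAction (dehomAction k G) U stable)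
  triangular : IsTriangular n (restrictAction (dehomAction k G) U stable)
  invariants_polynomial : Nonempty
    (invariants (restrictAction (dehomAction k G) U stable) ≃ₐ[k] MvPolynomial (Fin n) k)
  retract : ∃ I : Ideal (Dehom k G), (∀ g, ∀ x ∈ I, dehomAction k G g x ∈ I) ∧
    IsCompl (Subalgebra.toSubmodule U) (I.restrictScalars k)

end Algebra

/-! ### Affine varieties with a group action -/

section Geometry

variable {k : Type u} [Field k] {G : Type u} [Group G]

/-- An affine variety over an algebraically closed field `k`: a reduced affine `k`-scheme of finite
type (not necessarily irreducible). -/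
structure IsAffineVariety (X : Over (Spec (CommRingCat.of k))) : Prop where
  affine : IsAffine X.left
  reduced : IsReduced X.left
  finiteType : LocallyOfFiniteType X.hom

/-- The morphism by which `g` acts. -/
abbrev act (Y : Action (Over (Spec (CommRingCat.of k))) G) (g : G) : Y.V ⟶ Y.V := Y.ρ g

/-- `G` acts freely on (the closed points of) `Y`. -/
def IsFree (Y : Action (Over (Spec (CommRingCat.of k))) G) : Prop :=
  ∀ g : G, g ≠ 1 → ∀ y : Y.V.left, IsClosed {y} → (act Y g).left y ≠ y

/-- The regular functions on `Y` that are invariant under `G`. -/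
def invariantFunctions (Y : Action (Over (Spec (CommRingCat.of k))) G) :
    Subring Γ(Y.V.left, ⊤) where
  carrier := {s | ∀ g : G, (act Y g).left.appTop.hom s = s}
  mul_mem' ha hb g := by rw [map_mul, ha g, hb g]
  one_mem' g := map_one _
  add_mem' ha hb g := by rw [map_add, ha g, hb g]
  zero_mem' g := map_zero _
  neg_mem' ha g := by rw [map_neg, ha g]

/-- The inclusion `k → Γ(Y)` of the constants. -/
def constants (Y : Over (Spec (CommRingCat.of k))) : CommRingCat.of k ⟶ Γ(Y.left, ⊤) :=
  (Scheme.ΓSpecIso (CommRingCat.of k)).inv ≫ Y.hom.appTop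

lemma constants_mem (Y : Action (Over (Spec (CommRingCat.of k))) G) (c : k) :
    (constants Y.V).hom c ∈ invariantFunctions Y := by
  intro g
  have h : Y.V.hom.appTop ≫ (act Y g).left.appTop = Y.V.hom.appTop := by
    rw [← Scheme.Hom.comp_appTop, Over.w]
  have h2 : constants Y.V ≫ (act Y g).left.appTop = constants Y.V := by
    rw [constants, Category.assoc, h]
  exact congrArg (fun f => f.hom c) h2

/-- The quotient `Y/G` of an affine variety by a finite group: the spectrum of the ring of
invariant functions. -/
def quotient (Y : Action (Over (Spec (CommRingCat.of k))) G) : Over (Spec (CommRingCat.of k)) :=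
  Over.mk (Spec.map (CommRingCat.ofHom
    ((constants Y.V).hom.codRestrict (invariantFunctions Y) (constants_mem Y))))

/-- The projection `Y → Y/G`. -/
def quotientMap (Y : Action (Over (Spec (CommRingCat.of k))) G) : Y.V ⟶ quotient Y :=
  Over.homMk
    (Y.V.left.toSpecΓ ≫ Spec.map (CommRingCat.ofHom (invariantFunctions Y).subtype)) (by
      have h : CommRingCat.ofHom ((constants Y.V).hom.codRestrict (invariantFunctions Y)
          (constants_mem Y)) ≫ CommRingCat.ofHom (invariantFunctions Y).subtype
          = constants Y.V := by
        ext c; rfl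
      change (Y.V.left.toSpecΓ ≫ Spec.map _) ≫ Spec.map _ = _
      rw [Category.assoc, ← Spec.map_comp, h, constants, Spec.map_comp,
        ← Scheme.toSpecΓ_naturality_assoc]
      simp)

/-- The affine scheme with `G`-action belonging to a `k-G` algebra `R`: the element `g` acts on
points in such a way that `(g f)(x) = f(g⁻¹ x)` for functions `f`. -/
def specAction {R : Type u} [CommRing R] [Algebra k R] (σ : G →* (R →ₐ[k] R)) :
    Action (Over (Spec (CommRingCat.of k))) G where
  V := Over.mk (Spec.map (CommRingCat.ofHom (algebraMap k R)))
  ρ :=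
    { toFun := fun g => Over.homMk (Spec.map (CommRingCat.ofHom (σ g⁻¹).toRingHom)) (by
        change Spec.map _ ≫ Spec.map _ = Spec.map _
        rw [← Spec.map_comp, ← CommRingCat.ofHom_comp]
        congr 2
        exact (σ g⁻¹).comp_algebraMap)
      map_one' := by
        apply Over.OverMorphism.ext
        have h : (σ 1⁻¹).toRingHom = RingHom.id R := by
          ext r; simp
        simp only [Over.homMk_left, h]
        exact Spec.map_id _
      map_mul' := fun g h => by
        apply Over.OverMorphism.ext
        have h' : (σ (g * h)⁻¹).toRingHom = (σ h⁻¹).toRingHom.comp (σ g⁻¹).toRingHom := by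
          ext r; simp
        simp only [Over.homMk_left, h', CommRingCat.ofHom_comp, Spec.map_comp]
        rfl }

/-- The variety `B = Spec U`, with its `G`-action. -/
def varietyB [Fintype G] {n : ℕ} {U : Subalgebra k (Dehom k G)} (hU : IsStandard n U) :
    Action (Over (Spec (CommRingCat.of k))) G :=
  specAction (restrictAction (dehomAction k G) U hU.stable)

end Geometry

end FreeAction

end

noncomputable section

namespace FreeAction

/-! ### Traces, dual bases and Galois descent -/

section GaloisAlgebra

open TensorProduct

variable {k : Type u} [Field k] {G : Type u} [Group G]
variable {R : Type u} [CommRing R] [Algebra k R]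

/-! Everything rests on one element: some u with ∑ g(u) = 1. It makes additive cocycles coboundaries
(`action_neg_sum_cocycle`). Since |G| is a power of p it also yields Galois coordinates, ∑ xᵢ g(yᵢ)
= δ_{g,1} (`exists_galois_coordinates`). These push forward along equivariant homomorphisms and give
a dual basis for the trace form.

For a free action on an affine variety, maximal ideals are moved by every g ≠ 1, and prime avoidance
produces such a u (`exists_trace_eq_one_of_free`). The family g(u) defines an equivariant map D →
k[Y], hence U → k[Y]. The coordinates of U serve both algebras at once, so k[Y] is the base change
of U along U^G → k[Y]^G (`isPushout_of_dual_bases`), which is the fibre product statement. They also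
write each function on Y as a combination of images of the xᵢ with invariant coefficients. By
triangularity the last variable of U may be shifted by any invariant without losing equivariance, so
finitely many maps U → k[Y] have images generating k[Y]; this is the closed embedding. For the
existence of Y take G × X.

Standard subalgebras are built by induction along central extensions of Q by ⟨z⟩ of order p. From an
algebra R for Q form R[X] with g X = X + f(g), for a cocycle f with f(z) = 1. Power sums over the
prime field provide a trace-one element, and the invariants are R^Q[X^p − X − w] for a suitable w
(`range_artinSchreierHom`). The retraction from D is carried along by solving the same cocycle
equation inside D (`nonempty_standardModel_succ`). -/

lemma action_mul_apply (σ : G →* (R →ₐ[k] R)) (g h : G) (r : R) :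
    σ (g * h) r = σ g (σ h r) := by
  rw [map_mul]; rfl

@[simp] lemma action_one_apply (σ : G →* (R →ₐ[k] R)) (r : R) : σ 1 r = r := by
  rw [map_one]; rfl

lemma action_self_inv (σ : G →* (R →ₐ[k] R)) (g : G) (r : R) : σ g (σ g⁻¹ r) = r := by
  rw [← action_mul_apply]; simp

lemma mem_invariants {σ : G →* (R →ₐ[k] R)} {r : R} : r ∈ invariants σ ↔ ∀ g, σ g r = r :=
  Iff.rfl

/-- The algebra homomorphism `R ⊗ R → R`, `a ⊗ b ↦ a * g b`. -/
def mulTwist (σ : G →* (R →ₐ[k] R)) (g : G) : R ⊗[k] R →ₐ[k] R :=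
  Algebra.TensorProduct.lift (AlgHom.id k R) (σ g) fun _ _ => Commute.all _ _

@[simp] lemma mulTwist_tmul (σ : G →* (R →ₐ[k] R)) (g : G) (a b : R) :
    mulTwist σ g (a ⊗ₜ b) = a * σ g b := by
  simp [mulTwist]

variable [Fintype G]

lemma action_sum_action (σ : G →* (R →ₐ[k] R)) (h : G) (a : R) :
    σ h (∑ g, σ g a) = ∑ g, σ g a := by
  rw [map_sum]
  simp_rw [← action_mul_apply]
  exact Equiv.sum_comp (Equiv.mulLeft h) fun g => σ g a

/-- The trace `a ↦ ∑ g, g a`, as a map to the ring of invariants. -/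
def trace (σ : G →* (R →ₐ[k] R)) : R →ₗ[invariants σ] invariants σ where
  toFun a := ⟨∑ g, σ g a, fun h => action_sum_action σ h a⟩
  map_add' a b := by ext; simp [Finset.sum_add_distrib]
  map_smul' r a := by
    ext
    change ∑ g, σ g ((r : R) * a) = (r : R) * ∑ g, σ g a
    rw [Finset.mul_sum]
    exact Finset.sum_congr rfl fun g _ => by rw [map_mul, r.2 g]

/-- The trace is linear over the invariants, so its image is an ideal of R^G and contains everything
once it contains 1. -/
lemma isTraceSurjective_iff {σ : G →* (R →ₐ[k] R)} :
    IsTraceSurjective σ ↔ ∃ u : R, ∑ g, σ g u = 1 := by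
  refine ⟨fun h => h 1 (one_mem _), fun ⟨u, hu⟩ r hr => ⟨r * u, ?_⟩⟩
  simp_rw [map_mul, mem_invariants.1 hr, ← Finset.mul_sum, hu, mul_one]

/-- Over a field of characteristic `p`, if a finite `p`-group acts with a trace-one element,
then no element `g ≠ 1` acts trivially modulo a proper ideal. -/
lemma span_sub_action_eq_top {p n : ℕ} [Fact p.Prime] [CharP k p] (hG : Fintype.card G = p ^ n)
    (σ : G →* (R →ₐ[k] R)) {u : R} (hu : ∑ g, σ g u = 1) {g : G} (hg : g ≠ 1) :
    Ideal.span (Set.range fun y => y - σ g y) = ⊤ := by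
  set I := Ideal.span (Set.range fun y => y - σ g y) with hI
  rw [Ideal.eq_top_iff_one, ← Ideal.Quotient.eq_zero_iff_mem, ← hu, map_sum]
  have hinv : ∀ h : G, ∀ z ∈ Subgroup.zpowers g, ∀ y : R,
      Ideal.Quotient.mk I (σ (z * h) y) = Ideal.Quotient.mk I (σ h y) := by
    intro h z hz
    obtain ⟨m, rfl⟩ := Submonoid.mem_powers_iff _ _ |>.1 (mem_powers_iff_mem_zpowers.2 hz)
    induction m with
    | zero => simp
    | succ m ih =>
      intro y
      rw [← ih ⟨m, by simp⟩ y, pow_succ', mul_assoc, action_mul_apply σ g, eq_comm,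
        Ideal.Quotient.eq]
      exact Ideal.subset_span ⟨_, rfl⟩
  classical
  let s := QuotientGroup.rightRel (Subgroup.zpowers g)
  -- Modulo I the summand σ h u depends only on the right coset ⟨g⟩h, so each coset contributes
  -- orderOf g equal terms. As p divides orderOf g, the sum 1 vanishes modulo I.
  rw [← Finset.sum_fiberwise Finset.univ (fun h : G => (Quotient.mk s h))]
  refine Finset.sum_eq_zero fun q _ => ?_
  obtain ⟨h, rfl⟩ := Quotient.exists_rep q
  have hcard : (p : R) = 0 := by
    rw [← map_natCast (algebraMap k R), CharP.cast_eq_zero, map_zero]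
  have hfib : ∀ x ∈ Finset.univ.filter fun x : G => Quotient.mk s x = Quotient.mk s h,
      Ideal.Quotient.mk I (σ x u) = Ideal.Quotient.mk I (σ h u) := by
    intro x hx
    have hx' : s.r x h := Quotient.exact (Finset.mem_filter.1 hx).2
    have hm : x * h⁻¹ ∈ Subgroup.zpowers g := by
      have := QuotientGroup.rightRel_apply.1 (Setoid.symm hx')
      exact this
    have := hinv h _ hm u
    rwa [inv_mul_cancel_right] at this
  rw [Finset.sum_congr rfl hfib, Finset.sum_const]
  have hc : (Finset.univ.filter fun x : G => Quotient.mk s x = Quotient.mk s h).card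
      = orderOf g := by
    rw [← Fintype.card_zpowers, 
      Fintype.card_of_subtype (Finset.univ.filter fun x => x ∈ Subgroup.zpowers g) (by simp)]
    refine Finset.card_bij' (fun x _ => x * h⁻¹) (fun x _ => x * h) ?_ ?_ ?_ ?_
    · intro x hx
      have hx' : s.r x h := Quotient.exact (Finset.mem_filter.1 hx).2
      simpa using QuotientGroup.rightRel_apply.1 (Setoid.symm hx')
    · intro x hx
      refine Finset.mem_filter.2 ⟨Finset.mem_univ _, Quotient.sound (Setoid.symm ?_)⟩
      refine QuotientGroup.rightRel_apply.2 ?_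
      simpa using hx
    · simp
    · simp
  have hp : p ∣ orderOf g := by
    have h1 : orderOf g ∣ p ^ n := hG ▸ orderOf_dvd_card
    obtain ⟨m, -, hm⟩ := (Nat.dvd_prime_pow Fact.out).1 h1
    rw [hm]
    rcases m with _ | m
    · exact absurd (orderOf_eq_one_iff.1 (by simpa using hm)) hg
    · exact dvd_pow_self p (Nat.succ_ne_zero m)
  obtain ⟨c, hc'⟩ := hp
  rw [hc, hc', nsmul_eq_mul, ← map_natCast (Ideal.Quotient.mk I)]
  simp [hcard]

/-- Galois coordinates. -/
lemma exists_galois_coordinates {p n : ℕ} [Fact p.Prime] [CharP k p]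
    (hG : Fintype.card G = p ^ n) (σ : G →* (R →ₐ[k] R)) {u : R} (hu : ∑ g, σ g u = 1)
    [DecidableEq G] :
    ∃ (m : ℕ) (x y : Fin m → R), ∀ g : G, ∑ i, x i * σ g (y i) = if g = 1 then 1 else 0 := by
  have key : ∀ g : G, g ≠ 1 → ∃ e : R ⊗[k] R, mulTwist σ 1 e = 1 ∧ mulTwist σ g e = 0 := by
    intro g hg
    have h1 : (1 : R) ∈ Ideal.span (Set.range fun y => y - σ g y) := by
      rw [span_sub_action_eq_top hG σ hu hg]; trivial
    obtain ⟨c, hc⟩ := Finsupp.mem_ideal_span_range_iff_exists_finsupp.1 h1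
    -- With 1 = ∑ c_y (y − g y), the element ∑ c_y ⊗ y is corrected by a scalar from the left factor
    -- so that its g-twist is 0; its untwisted product is then exactly that sum.
    refine ⟨(c.sum fun y a => a ⊗ₜ y) - (c.sum fun y a => a * σ g y) ⊗ₜ 1, ?_, ?_⟩
    · rw [map_sub, Finsupp.sum, map_sum, Finsupp.sum, mulTwist_tmul]
      simp only [mulTwist_tmul, action_one_apply, mul_one]
      rw [← hc, Finsupp.sum, ← Finset.sum_sub_distrib]
      simp only [mul_sub]
    · rw [map_sub, Finsupp.sum, map_sum, Finsupp.sum, mulTwist_tmul]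
      simp
  choose! e he1 heg using key
  -- The twists are ring homomorphisms, so the product over g ≠ 1 is sent to 1 by the untwisted one
  -- and to 0 by all others.
  obtain ⟨S, hS⟩ := TensorProduct.exists_finset (∏ g ∈ Finset.univ.erase (1 : G), e g)
  have hS' : ∀ g : G, ∑ z ∈ S, z.1 * σ g z.2 = if g = 1 then 1 else 0 := by
    intro g
    have : ∑ z ∈ S, z.1 * σ g z.2 = mulTwist σ g (∏ g ∈ Finset.univ.erase (1 : G), e g) := by
      rw [hS, map_sum]; simp
    rw [this, map_prod]
    split_ifs with h
    · subst h
      exact Finset.prod_eq_one fun g hg => he1 g (Finset.ne_of_mem_erase hg)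
    · exact Finset.prod_eq_zero (Finset.mem_erase.2 ⟨h, Finset.mem_univ g⟩) (heg g h)
  refine ⟨S.card, fun i => (S.equivFin.symm i).1.1, fun i => (S.equivFin.symm i).1.2, fun g => ?_⟩
  rw [← hS' g, ← Finset.sum_coe_sort S]
  exact Equiv.sum_comp S.equivFin.symm fun z : S => z.1.1 * σ g z.1.2

/-- A ring extension with a trace form and dual bases is preserved by base change along every
extension to which the trace and the dual bases carry over. -/
lemma isPushout_of_dual_bases {S U R A : Type u} [CommRing S] [CommRing U] [CommRing R]
    [CommRing A] [Algebra S U] [Algebra S R] [Algebra S A] [Algebra U A] [Algebra R A]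
    [IsScalarTower S U A] [IsScalarTower S R A] (tU : U →ₗ[S] S) (tA : A →ₗ[R] R)
    (hcomp : ∀ u, tA (algebraMap U A u) = algebraMap S R (tU u))
    {m : ℕ} (x y : Fin m → U) (hU : ∀ u, ∑ i, tU (u * y i) • x i = u)
    (hA : ∀ a, ∑ i, tA (a * algebraMap U A (y i)) • algebraMap U A (x i) = a) :
    Algebra.IsPushout S R U A := by
  constructor
  let L : R ⊗[S] U →ₗ[R] A :=
    (Algebra.TensorProduct.lift (Algebra.ofId R A) (IsScalarTower.toAlgHom S U A)
      fun _ _ => Commute.all _ _).toLinearMap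
  have hL : ∀ r u, L (r ⊗ₜ u) = r • algebraMap U A u := fun r u => by
    simp [L, Algebra.ofId_apply, Algebra.smul_def]
  -- The inverse of multiplication is the expansion in the dual bases, with the trace coefficients
  -- kept in the left factor.
  let M : A →ₗ[R] R ⊗[S] U :=
    { toFun := fun a => ∑ i, tA (a * algebraMap U A (y i)) ⊗ₜ x i
      map_add' := fun a b => by
        simp [add_mul, TensorProduct.add_tmul, Finset.sum_add_distrib]
      map_smul' := fun r a => by
        simp [Finset.smul_sum, TensorProduct.smul_tmul'] }
  have hLM : L ∘ₗ M = LinearMap.id := by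
    ext a
    simp only [M, LinearMap.comp_apply, LinearMap.coe_mk, AddHom.coe_mk, map_sum, hL]
    exact hA a
  have hML : M ∘ₗ L = LinearMap.id := by
    apply TensorProduct.AlgebraTensorModule.ext
    intro r u
    rw [LinearMap.comp_apply, hL, map_smul, LinearMap.id_apply]
    simp only [M, LinearMap.coe_mk, AddHom.coe_mk, ← map_mul, hcomp]
    conv_rhs => rw [← hU u]
    rw [TensorProduct.tmul_sum, Finset.smul_sum]
    refine Finset.sum_congr rfl fun i _ => ?_
    rw [TensorProduct.tmul_smul, TensorProduct.smul_tmul', TensorProduct.smul_tmul',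
      Algebra.smul_def (tU _) r, smul_eq_mul, mul_comm]
  refine IsBaseChange.of_equiv (LinearEquiv.ofLinearMap L M hLM hML) fun u => ?_
  simp [hL]

/-- A finite group acting on a ring without fixed maximal ideals has a trace-one element. -/
lemma exists_trace_eq_one_of_free (σ : G →* (R →ₐ[k] R))
    (hfree : ∀ g : G, g ≠ 1 → ∀ M : Ideal R, M.IsMaximal → M.comap (σ g) ≠ M) :
    ∃ u : R, ∑ g, σ g u = 1 := by
  by_contra hne
  let _ : MulSemiringAction G R :=
    { smul := fun g r => σ g r
      one_smul := fun r => action_one_apply σ r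
      mul_smul := fun g h r => action_mul_apply σ g h r
      smul_zero := fun g => map_zero (σ g)
      smul_add := fun g => map_add (σ g)
      smul_one := fun g => map_one (σ g)
      smul_mul := fun g => map_mul (σ g) }
  have : Algebra.IsInvariant (invariants σ) R G := ⟨fun b hb => ⟨⟨b, hb⟩, rfl⟩⟩
  have : SMulCommClass G (invariants σ) R :=
    ⟨fun g r x => by
      change σ g ((r : R) * x) = (r : R) * σ g x
      rw [map_mul, r.2 g]⟩
  have : Algebra.IsIntegral (invariants σ) R := Algebra.IsInvariant.isIntegral _ _ G
  have hproper : LinearMap.range (trace σ) ≠ ⊤ := by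
    intro h
    obtain ⟨u, hu⟩ := (LinearMap.range_eq_top.1 h) 1
    exact hne ⟨u, congrArg Subtype.val hu⟩
  -- If 1 is not a trace, the traces form a proper ideal of R^G. Integrality lifts a maximal ideal
  -- containing it to a maximal ideal M of R, which therefore contains all traces.
  obtain ⟨m, hm, hle⟩ := Ideal.exists_le_maximal (LinearMap.range (trace σ)) hproper
  obtain ⟨M, hM, hMm⟩ := Ideal.exists_ideal_over_maximal_of_isIntegral (S := R) m (by
    intro x hx
    have : x = 0 := Subtype.ext hx
    rw [this]; exact zero_mem _)
  have htr : ∀ a : R, ∑ g, σ g a ∈ M := fun a => by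
    have : trace σ a ∈ M.comap (algebraMap (invariants σ) R) := hMm ▸ hle ⟨a, rfl⟩
    exact this
  classical
  have hmax : ∀ g : G, (M.comap (σ g)).IsMaximal := fun g =>
    Ideal.comap_isMaximal_of_surjective _ fun r => ⟨σ g⁻¹ r, action_self_inv σ g r⟩
  -- Prime avoidance gives a outside M with g a ∈ M for all g ≠ 1. Then ∑ g a ∈ M forces a ∈ M, a
  -- contradiction.
  have hinf : ¬ (Finset.univ.erase (1 : G)).inf (fun g => M.comap (σ g)) ≤ M := by
    intro h
    obtain ⟨g, hg, hgM⟩ := (Ideal.IsPrime.inf_le' hM.isPrime).1 h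
    exact hfree g (Finset.ne_of_mem_erase hg) M hM ((hmax g).eq_of_le hM.ne_top hgM)
  obtain ⟨a, ha, haM⟩ := SetLike.not_le_iff_exists.1 hinf
  refine haM ?_
  have h1 := htr a
  rw [← Finset.add_sum_erase _ _ (Finset.mem_univ (1 : G)), action_one_apply] at h1
  refine (Submodule.add_mem_iff_left M (Submodule.sum_mem _ fun g hg => ?_)).1 h1
  exact (Finset.inf_le (f := fun g => M.comap (σ g)) hg) ha

end GaloisAlgebra

/-! ### The universal trace-surjective algebra and equivariant homomorphisms -/

section Universal

variable {k : Type u} [Field k] {G : Type u} [Group G] [Fintype G]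
variable {R : Type u} [CommRing R] [Algebra k R] {A : Type u} [CommRing A] [Algebra k A]

/-- A homomorphism of `k-G` algebras. -/
def IsEquivariant (σ : G →* (R →ₐ[k] R)) (τ : G →* (A →ₐ[k] A)) (φ : R →ₐ[k] A) : Prop :=
  ∀ g r, φ (σ g r) = τ g (φ r)

/-- The generator `X_g` of `Dehom k G`. -/
def dehomX (k : Type u) [Field k] {G : Type u} [Group G] [Fintype G] (g : G) : Dehom k G :=
  Ideal.Quotient.mkₐ k _ (MvPolynomial.X g)

lemma sum_dehomX : ∑ g : G, dehomX k g = 1 := by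
  simp only [dehomX]
  rw [← map_sum, ← map_one (Ideal.Quotient.mkₐ k _), ← sub_eq_zero, ← map_sub]
  exact Ideal.Quotient.eq_zero_iff_mem.2 (Ideal.mem_span_singleton_self _)

@[simp] lemma dehomAction_dehomX (g h : G) :
    dehomAction k G g (dehomX k h) = dehomX k (g * h) := by
  change Ideal.Quotient.mk _ (MvPolynomial.rename (g * ·) (MvPolynomial.X h)) = _
  rw [MvPolynomial.rename_X]; rfl

lemma dehom_algHom_ext {φ ψ : Dehom k G →ₐ[k] A} (h : ∀ g, φ (dehomX k g) = ψ (dehomX k g)) :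
    φ = ψ := by
  apply Ideal.Quotient.algHom_ext
  apply MvPolynomial.algHom_ext
  exact h

/-- The homomorphism from `Dehom k G` given by elements with sum one. -/
def dehomLift (a : G → A) (ha : ∑ g, a g = 1) : Dehom k G →ₐ[k] A :=
  Ideal.Quotient.liftₐ _ (MvPolynomial.aeval a) (by
    have : Ideal.span {(∑ g : G, MvPolynomial.X g - 1 : MvPolynomial G k)}
        ≤ RingHom.ker (MvPolynomial.aeval (R := k) a) := by
      rw [Ideal.span_singleton_le_iff_mem, RingHom.mem_ker]
      simp [ha]
    exact this)

@[simp] lemma dehomLift_dehomX (a : G → A) (ha : ∑ g, a g = 1) (g : G) :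
    dehomLift (k := k) a ha (dehomX k g) = a g :=
  MvPolynomial.aeval_X a g

lemma sum_dehomAction_dehomX_one : ∑ g, dehomAction k G g (dehomX k 1) = 1 := by
  simp [sum_dehomX]

/-- The universal property of D: every trace-one element of a k-G algebra receives X_1 under an
equivariant homomorphism. -/
lemma isEquivariant_dehomLift (τ : G →* (A →ₐ[k] A)) {u : A} (hu : ∑ g, τ g u = 1) :
    IsEquivariant (dehomAction k G) τ (dehomLift (fun g => τ g u) hu) := by
  intro g
  refine DFunLike.congr_fun (f := (dehomLift (fun g => τ g u) hu).comp (dehomAction k G g))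
    (g := (τ g).comp (dehomLift (fun g => τ g u) hu)) (dehom_algHom_ext fun h => ?_)
  simp

/-- In the presence of a trace-one element, additive cocycles are coboundaries. -/
lemma action_neg_sum_cocycle (τ : G →* (A →ₐ[k] A)) {u : A} (hu : ∑ g, τ g u = 1) {F : G → A}
    (hF : ∀ g h, F (g * h) = F g + τ g (F h)) (g : G) :
    τ g (-∑ h, F h * τ h u) = -∑ h, F h * τ h u + F g := by
  have h1 : τ g (∑ h, F h * τ h u) = ∑ h, (F (g * h) - F g) * τ (g * h) u := by
    rw [map_sum]
    refine Finset.sum_congr rfl fun h _ => ?_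
    rw [map_mul, hF, ← action_mul_apply]; ring
  have h2 : ∑ h, (F (g * h) - F g) * τ (g * h) u = ∑ h, (F h - F g) * τ h u :=
    Equiv.sum_comp (Equiv.mulLeft g) fun h => (F h - F g) * τ h u
  rw [map_neg, h1, h2]
  simp_rw [sub_mul]
  rw [Finset.sum_sub_distrib, ← Finset.mul_sum, hu]
  ring

/-- Expanding the traces and exchanging the sums leaves ∑ g(a) φ(∑ xᵢ g(yᵢ)), where only g = 1
survives. Thus φ(xᵢ), φ(yᵢ) are dual bases of A over its invariants for the trace form; coordinates
for the source suffice. -/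
lemma sum_smul_galois_coordinates [DecidableEq G] (σ : G →* (R →ₐ[k] R)) (τ : G →* (A →ₐ[k] A))
    {φ : R →ₐ[k] A} (hφ : IsEquivariant σ τ φ) {m : ℕ} {x y : Fin m → R}
    (hxy : ∀ g : G, ∑ i, x i * σ g (y i) = if g = 1 then 1 else 0) (a : A) :
    ∑ i, trace τ (a * φ (y i)) • φ (x i) = a := by
  change ∑ i, (∑ g, τ g (a * φ (y i))) * φ (x i) = a
  simp_rw [Finset.sum_mul]
  rw [Finset.sum_comm]
  have : ∀ g, ∑ i, τ g (a * φ (y i)) * φ (x i) = τ g a * if g = 1 then 1 else 0 := by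
    intro g
    have h := congrArg φ (hxy g)
    rw [map_sum] at h
    have h' : (if g = 1 then (1 : A) else 0) = φ (if g = 1 then 1 else 0) := by
      split_ifs <;> simp
    rw [h', ← h, Finset.mul_sum]
    refine Finset.sum_congr rfl fun i _ => ?_
    rw [map_mul, map_mul, hφ g (y i)]; ring
  simp_rw [this]
  simp

omit [Fintype G] in
/-- Translating the image of the last variable of a triangular algebra by an invariant. -/
lemma exists_equivariant_translate {n : ℕ} (hn : n ≠ 0) {σ : G →* (R →ₐ[k] R)}
    {τ : G →* (A →ₐ[k] A)} (hσ : IsTriangular n σ) {φ : R →ₐ[k] A} (hφ : IsEquivariant σ τ φ)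
    (c : invariants τ) :
    ∃ (φ' : R →ₐ[k] A) (t : R), IsEquivariant σ τ φ' ∧ φ' t = φ t + c := by
  obtain ⟨n, rfl⟩ := Nat.exists_eq_succ_of_ne_zero hn
  obtain ⟨e, he⟩ := hσ
  -- Only the image of the last variable changes. The polynomials f_{g,i} involve earlier variables
  -- only, so they keep their values, and c, being invariant, appears on both sides of the
  -- equivariance equation.
  let v : Fin (n + 1) → A := fun i =>
    φ (e (MvPolynomial.X i)) + if i = Fin.last n then (c : A) else 0
  let θ : MvPolynomial (Fin (n + 1)) k →ₐ[k] A := MvPolynomial.aeval v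
  have hθ : ∀ i, ∀ f ∈ MvPolynomial.supported k {j : Fin (n + 1) | j < i},
      θ f = φ (e f) := by
    intro i f hf
    rw [MvPolynomial.mem_supported] at hf
    have : ((θ : MvPolynomial (Fin (n + 1)) k →ₐ[k] A) : _ →+* A) f
        = ((φ.comp e.toAlgHom : MvPolynomial (Fin (n + 1)) k →ₐ[k] A) : _ →+* A) f := by
      refine MvPolynomial.hom_congr_vars ?_ ?_ rfl
      · ext r
        change θ (algebraMap _ _ r) = (φ.comp e.toAlgHom) (algebraMap _ _ r)
        rw [AlgHom.commutes, AlgHom.commutes]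
      · intro j hj _
        have hji : j < i := hf hj
        have hne : j ≠ Fin.last n := (lt_of_lt_of_le hji (Fin.le_last i)).ne
        change θ (MvPolynomial.X j) = φ (e (MvPolynomial.X j))
        simp [θ, v, hne]
    exact this
  refine ⟨θ.comp e.symm.toAlgHom, e (MvPolynomial.X (Fin.last n)), fun g => ?_, by simp [θ, v]⟩
  have hcomp : ((θ.comp e.symm.toAlgHom).comp (σ g)).comp e.toAlgHom
      = ((τ g).comp (θ.comp e.symm.toAlgHom)).comp e.toAlgHom := by
    apply MvPolynomial.algHom_ext
    intro i
    obtain ⟨f, hf, hg⟩ := he g i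
    have h1 : φ (e f) = τ g (φ (e (MvPolynomial.X i))) - φ (e (MvPolynomial.X i)) := by
      rw [← hφ, hg, map_add, add_sub_cancel_left]
    have h2 : τ g (if i = Fin.last n then (c : A) else 0)
        = if i = Fin.last n then (c : A) else 0 := by
      split_ifs
      · exact c.2 g
      · simp
    change θ (e.symm (σ g (e (MvPolynomial.X i)))) = τ g (θ (e.symm (e (MvPolynomial.X i))))
    rw [hg, map_add, map_add, e.symm_apply_apply, e.symm_apply_apply, hθ i f hf, h1]
    simp only [θ, v, MvPolynomial.aeval_X, map_add, h2]
    ring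
  intro r
  have := DFunLike.congr_fun hcomp (e.symm r)
  simpa using this

/-- A generator b equals ∑ cᵢ φ(xᵢ) with invariant cᵢ = tr(b φ(yᵢ)), and each cᵢ is the difference
of a translate of φ and φ at one element. So φ and one translate per pair (b, i) suffice. -/
lemma exists_equivariant_generators {p n : ℕ} [Fact p.Prime] [CharP k p]
    (hG : Fintype.card G = p ^ n) {m : ℕ} (hm : m ≠ 0) {σ : G →* (R →ₐ[k] R)}
    {τ : G →* (A →ₐ[k] A)} (hσ : IsTriangular m σ) (htr : IsTraceSurjective σ)
    {φ : R →ₐ[k] A} (hφ : IsEquivariant σ τ φ) [Algebra.FiniteType k A] :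
    ∃ (N : ℕ) (Φ : Fin N → R →ₐ[k] A), (∀ i, IsEquivariant σ τ (Φ i)) ∧
      ⨆ i, (Φ i).range = ⊤ := by
  classical
  obtain ⟨u, hu⟩ := isTraceSurjective_iff.1 htr
  obtain ⟨l, x, y, hxy⟩ := exists_galois_coordinates hG σ hu
  obtain ⟨s, hs⟩ := (inferInstance : Algebra.FiniteType k A).out
  choose φ' t hφ' ht using fun c : invariants τ => exists_equivariant_translate hm hσ hφ c
  let Ψ : Option (s × Fin l) → R →ₐ[k] A := fun o =>
    o.elim φ fun bi => φ' (trace τ (bi.1 * φ (y bi.2)))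
  have hΨ' : ∀ o, IsEquivariant σ τ (Ψ o) := by
    rintro (_ | bi)
    · exact hφ
    · exact hφ' _
  have hΨ : ⨆ o, (Ψ o).range = ⊤ := by
    rw [eq_top_iff, ← hs, Algebra.adjoin_le_iff]
    intro b hb
    have hmem : ∀ o r, Ψ o r ∈ ⨆ o, (Ψ o).range := fun o r =>
      (le_iSup (fun o => (Ψ o).range) o) ⟨r, rfl⟩
    rw [← sum_smul_galois_coordinates σ τ hφ hxy b]
    refine Subalgebra.sum_mem _ fun i _ => ?_
    refine Subalgebra.mul_mem _ ?_ (hmem none (x i))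
    have := Subalgebra.sub_mem _ (hmem (some (⟨b, hb⟩, i)) (t (trace τ (b * φ (y i)))))
      (hmem none (t (trace τ (b * φ (y i)))))
    simpa [Ψ, ht] using this
  let e := Fintype.equivFin (Option (s × Fin l))
  refine ⟨_, fun i => Ψ (e.symm i), fun i => hΨ' _, ?_⟩
  · rw [← hΨ]
    exact e.symm.iSup_comp (g := fun o => (Ψ o).range)

end Universal

/-! ### Power sums in characteristic `p` -/

section PowerSums

variable {A : Type u} [CommRing A] (p : ℕ) [Fact p.Prime] [CharP A p]

lemma sum_range_natCast_eq_sum_zmod {M : Type*} [AddCommMonoid M] (F : A → M) :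
    ∑ i ∈ Finset.range p, F (i : A) = ∑ j : ZMod p, F (ZMod.castHom dvd_rfl A j) := by
  refine Finset.sum_bij' (fun i _ => (i : ZMod p)) (fun j _ => j.val) (by simp)
    (fun j _ => Finset.mem_range.2 (ZMod.val_lt j))
    (fun i hi => ZMod.val_cast_of_lt (Finset.mem_range.1 hi)) (by simp) (by simp)

lemma sum_zmod_pow_sub_one : ∑ j : ZMod p, j ^ (p - 1) = -1 := by
  simp_rw [ZMod.pow_card_sub_one]
  rw [Finset.sum_ite]
  simp [Finset.filter_ne', ZMod.card, (Fact.out : p.Prime).one_le]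

/-- In the binomial expansion the power sums over the prime field with exponent below p − 1 vanish
(exponent 0 included), and the top one is −1. -/
lemma sum_add_natCast_pow_sub_one (s : A) :
    ∑ i ∈ Finset.range p, (s + i) ^ (p - 1) = -1 := by
  rw [sum_range_natCast_eq_sum_zmod p fun x : A => (s + x) ^ (p - 1)]
  simp_rw [add_pow]
  rw [Finset.sum_comm, Finset.sum_eq_single_of_mem 0 (by simp)]
  · simp_rw [← map_pow]
    rw [← Finset.sum_mul, ← Finset.mul_sum, ← map_sum, Nat.sub_zero, sum_zmod_pow_sub_one]
    simp
  · intro m hm hm0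
    have hlt : p - 1 - m < Fintype.card (ZMod p) - 1 := by
      rw [ZMod.card]
      have := (Fact.out : p.Prime).two_le
      omega
    simp_rw [← map_pow]
    rw [← Finset.sum_mul, ← Finset.mul_sum, ← map_sum,
      FiniteField.sum_pow_lt_card_sub_one _ _ hlt]
    simp

/-- Frobenius is additive and fixes the prime field, and p copies of s^p cancel. The right side is 0
for odd p but 1 for p = 2, so it is left as a sum. -/
lemma sum_add_natCast_pow (s : A) :
    ∑ i ∈ Finset.range p, (s + i) ^ p = ∑ i ∈ Finset.range p, (i : A) := by
  have : ∀ i : ℕ, (i : A) ^ p = i := fun i => by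
    rw [← Nat.cast_pow, ← map_natCast (ZMod.castHom dvd_rfl A), Nat.cast_pow, ZMod.pow_card,
      map_natCast]
  simp [add_pow_char, Finset.sum_add_distrib, this]

end PowerSums

/-! ### Central extensions by a cyclic group of order `p` -/

/-- `q : G → Q` is a surjection whose kernel is central and generated by `z`, of order `p`. -/
structure IsCentralExtension {G Q : Type u} [Group G] [Group Q] (p : ℕ) (q : G →* Q) (z : G) :
    Prop where
  surjective : Function.Surjective q
  central : ∀ x, z * x = x * z
  ker_eq : q.ker = Subgroup.zpowers z
  orderOf_eq : orderOf z = p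

namespace IsCentralExtension

variable {k : Type u} [Field k] {G Q : Type u} [Group G] [Group Q]
  {p : ℕ} [Fact p.Prime] {q : G →* Q} {z : G}

omit [Fact p.Prime] in
lemma map_gen (h : IsCentralExtension p q z) : q z = 1 := by
  rw [← MonoidHom.mem_ker, h.ker_eq]; exact Subgroup.mem_zpowers z

lemma exists_pow (h : IsCentralExtension p q z) {x y : G} (hxy : q x = q y) :
    ∃ i < p, x * z ^ i = y := by
  have h1 : x⁻¹ * y ∈ Subgroup.zpowers z := by
    rw [← h.ker_eq, MonoidHom.mem_ker, map_mul, map_inv, hxy, inv_mul_cancel]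
  have hz : IsOfFinOrder z := orderOf_pos_iff.1 (h.orderOf_eq ▸ (Fact.out : p.Prime).pos)
  obtain ⟨i, hi⟩ := Submonoid.mem_powers_iff _ _ |>.1 (hz.mem_powers_iff_mem_zpowers.2 h1)
  refine ⟨i % p, Nat.mod_lt _ (Fact.out : p.Prime).pos, ?_⟩
  rw [← h.orderOf_eq, pow_mod_orderOf, hi, mul_inv_cancel_left]

omit [Fact p.Prime] in
lemma map_mul_pow (h : IsCentralExtension p q z) (x : G) (i : ℕ) : q (x * z ^ i) = q x := by
  rw [map_mul, map_pow, h.map_gen, one_pow, mul_one]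

lemma sum_fiber [Fintype G] [DecidableEq Q] (h : IsCentralExtension p q z) {M : Type*}
    [AddCommMonoid M] (F : G → M) (x : G) :
    ∑ g with q g = q x, F g = ∑ i ∈ Finset.range p, F (x * z ^ i) := by
  symm
  refine Finset.sum_bij (fun i _ => x * z ^ i) ?_ ?_ ?_ fun _ _ => rfl
  · intro i _
    simp [h.map_mul_pow, -map_mul]
  · intro i hi j hj hij
    refine pow_injOn_Iio_orderOf ?_ ?_ (mul_left_cancel hij)
    · simpa [h.orderOf_eq] using hi
    · simpa [h.orderOf_eq] using hj
  · intro g hg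
    obtain ⟨i, hi, hig⟩ := h.exists_pow (Finset.mem_filter.1 hg).2.symm
    exact ⟨i, Finset.mem_range.2 hi, hig⟩

/-- Fix a set-theoretic section of q and let l(x) be the exponent of z in x relative to it. It is
defined modulo p, hence in k; l is not a homomorphism. -/
lemma exists_coordinate [CharP k p] (h : IsCentralExtension p q z) :
    ∃ l : G → k, ∀ x, l (x * z) = l x + 1 := by
  let s := Function.surjInv h.surjective
  have hs : ∀ x, q (s (q x)) = q x := fun x => Function.surjInv_eq h.surjective _
  choose i _ hi using fun x => h.exists_pow (hs x)
  refine ⟨fun x => i x, fun x => ?_⟩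
  have h1 : z ^ i (x * z) = z ^ (i x + 1) := by
    have h2 := hi (x * z)
    have h3 : q (x * z) = q x := by simpa using h.map_mul_pow x 1
    rw [h3] at h2
    refine mul_left_cancel (a := s (q x)) ?_
    rw [h2, pow_succ, ← mul_assoc, hi x]
  have h2 : i (x * z) ≡ i x + 1 [MOD p] := h.orderOf_eq ▸ pow_eq_pow_iff_modEq.1 h1
  have h3 := (CharP.cast_eq_iff_mod_eq k p).2 h2
  simpa using h3

/-- Take l with l(xz) = l(x) + 1. The function x ↦ l(x) − l(g⁻¹x) is unchanged under x ↦ xz, so it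
descends to Q, and it is a cocycle with values in functions on Q, equal to 1 at g = z. The
equivariant map sending the indicator of y to y(u) takes it to R and takes 1 to ∑ y(u) = 1. -/
lemma exists_cocycle [Fintype Q] [CharP k p] (h : IsCentralExtension p q z) {R : Type u}
    [CommRing R] [Algebra k R] (σ : Q →* (R →ₐ[k] R)) {u : R} (hu : ∑ y, σ y u = 1) :
    ∃ f : G → R, (∀ g g', f (g * g') = f g + σ (q g) (f g')) ∧ f z = 1 := by
  obtain ⟨l, hl⟩ := h.exists_coordinate (k := k)
  have hl' : ∀ x (i : ℕ), l (x * z ^ i) = l x + i := by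
    intro x i
    induction i with
    | zero => simp
    | succ i ih => rw [pow_succ, ← mul_assoc, hl, ih]; push_cast; ring
  let s := Function.surjInv h.surjective
  have hs : ∀ x, q x = q (s (q x)) := fun x => (Function.surjInv_eq h.surjective _).symm
  let μ : G → Q → k := fun g y => l (s y) - l (g⁻¹ * s y)
  have hμ : ∀ g x, μ g (q x) = l x - l (g⁻¹ * x) := by
    intro g x
    obtain ⟨i, -, hi⟩ := h.exists_pow (hs x)
    simp only [μ, ← hi, ← mul_assoc, hl']
    ring
  refine ⟨fun g => ∑ y, μ g y • σ y u, fun g g' => ?_, ?_⟩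
  · have h1 : ∀ y, μ (g * g') y = μ g y + μ g' ((q g)⁻¹ * y) := by
      intro y
      obtain ⟨x, rfl⟩ := h.surjective y
      rw [← map_inv, ← map_mul, hμ, hμ, hμ, mul_inv_rev, mul_assoc]
      ring
    simp_rw [h1, add_smul]
    rw [Finset.sum_add_distrib, map_sum]
    congr 1
    rw [← Equiv.sum_comp (Equiv.mulLeft (q g))]
    refine Finset.sum_congr rfl fun y _ => ?_
    rw [map_smul, ← action_mul_apply]
    simp
  · have h1 : ∀ y, μ z y = 1 := by
      intro y
      obtain ⟨x, rfl⟩ := h.surjective y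
      have h2 : z⁻¹ * x * z = x := by rw [mul_assoc, ← h.central, inv_mul_cancel_left]
      rw [hμ]
      have h3 := hl (z⁻¹ * x)
      rw [h2] at h3
      rw [h3]; ring
    simp_rw [h1, one_smul, hu]

end IsCentralExtension

/-! ### Extending a triangular action along a central extension -/

section Extension

open Polynomial

variable {k : Type u} [Field k] {G Q : Type u} [Group G] [Group Q]
variable {R : Type u} [CommRing R] [Algebra k R]

/-- The action of `G` on `R[X]` with `g X = X + f g`, for a cocycle `f`. -/
def extAction (q : G →* Q) (σ : Q →* (R →ₐ[k] R)) (f : G → R)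
    (hf : ∀ g h, f (g * h) = f g + σ (q g) (f h)) : G →* (R[X] →ₐ[k] R[X]) where
  toFun g := aevalTower ((CAlgHom (R := k)).comp (σ (q g))) (X + C (f g))
  map_one' := by
    have h1 : f 1 = 0 := by simpa using hf 1 1
    apply Polynomial.algHom_ext'
    · ext r; simp
    · simp [h1]
  map_mul' g h := by
    apply Polynomial.algHom_ext'
    · ext r; simp
    · simp [hf]; ring

variable {q : G →* Q} {σ : Q →* (R →ₐ[k] R)} {f : G → R}
  (hf : ∀ g h, f (g * h) = f g + σ (q g) (f h))

@[simp] lemma extAction_C (g : G) (r : R) : extAction q σ f hf g (C r) = C (σ (q g) r) := by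
  simp [extAction]

@[simp] lemma extAction_X (g : G) : extAction q σ f hf g X = X + C (f g) := by
  simp [extAction]

lemma extAction_apply (g : G) (P : R[X]) :
    extAction q σ f hf g P = (P.map (σ (q g) : R →+* R)).comp (X + C (f g)) := by
  rw [comp, eval₂_map]; rfl

lemma degree_extAction_le (g : G) (P : R[X]) : (extAction q σ f hf g P).degree ≤ P.degree := by
  nontriviality R
  by_cases h0 : extAction q σ f hf g P = 0
  · simp [h0]
  have hP : P ≠ 0 := by rintro rfl; simp at h0
  rw [degree_eq_natDegree h0, degree_eq_natDegree hP, Nat.cast_le, extAction_apply]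
  refine natDegree_comp_le.trans ?_
  rw [natDegree_X_add_C, mul_one]
  exact natDegree_map_le

/-- The variables of a polynomial ring in `n + 1` variables, the last one becoming `X`. -/
def snocEquiv (n : ℕ) (e : MvPolynomial (Fin n) k ≃ₐ[k] R) :
    MvPolynomial (Fin (n + 1)) k ≃ₐ[k] R[X] :=
  ((MvPolynomial.renameEquiv k finSuccEquivLast).trans
    (MvPolynomial.optionEquivLeft k (Fin n))).trans (Polynomial.mapAlgEquiv e)

lemma snocEquiv_X_last (n : ℕ) (e : MvPolynomial (Fin n) k ≃ₐ[k] R) :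
    snocEquiv n e (MvPolynomial.X (Fin.last n)) = X := by
  simp [snocEquiv]

lemma snocEquiv_X_castSucc (n : ℕ) (e : MvPolynomial (Fin n) k ≃ₐ[k] R) (i : Fin n) :
    snocEquiv n e (MvPolynomial.X i.castSucc) = C (e (MvPolynomial.X i)) := by
  simp [snocEquiv]

lemma snocEquiv_rename (n : ℕ) (e : MvPolynomial (Fin n) k ≃ₐ[k] R)
    (P : MvPolynomial (Fin n) k) :
    snocEquiv n e (MvPolynomial.rename Fin.castSucc P) = C (e P) := by
  have : (snocEquiv n e).toAlgHom.comp (MvPolynomial.rename Fin.castSucc)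
      = (CAlgHom (R := k)).comp e.toAlgHom := by
    apply MvPolynomial.algHom_ext
    intro i
    simpa using snocEquiv_X_castSucc n e i
  exact DFunLike.congr_fun this P

lemma isTriangular_extAction {n : ℕ} (hσ : IsTriangular n σ) :
    IsTriangular (n + 1) (extAction q σ f hf) := by
  obtain ⟨e, he⟩ := hσ
  have hsupp : ∀ (P : MvPolynomial (Fin n) k) (i : Fin (n + 1)),
      (∀ j ∈ P.vars, j.castSucc < i) →
      MvPolynomial.rename Fin.castSucc P ∈ MvPolynomial.supported k {j | j < i} := by
    intro P i hP
    rw [MvPolynomial.mem_supported]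
    intro j hj
    classical
    obtain ⟨l, hl, rfl⟩ := Finset.mem_image.1 (MvPolynomial.vars_rename _ _ hj)
    exact hP l hl
  refine ⟨snocEquiv n e, fun g i => ?_⟩
  induction i using Fin.lastCases with
  | last =>
    refine ⟨MvPolynomial.rename Fin.castSucc (e.symm (f g)),
      hsupp _ _ fun j _ => Fin.castSucc_lt_last j, ?_⟩
    rw [snocEquiv_X_last, snocEquiv_rename, extAction_X, e.apply_symm_apply]
  | cast i =>
    obtain ⟨P, hP, hg⟩ := he (q g) i
    refine ⟨MvPolynomial.rename Fin.castSucc P, hsupp _ _ fun j hj => ?_, ?_⟩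
    · exact Fin.castSucc_lt_castSucc_iff.2 (MvPolynomial.mem_supported.1 hP hj)
    · rw [snocEquiv_X_castSucc, snocEquiv_rename, extAction_C, hg, map_add]

variable {p : ℕ} [Fact p.Prime] {z : G}

include hf in
omit [Fact p.Prime] in
lemma cocycle_mul_pow (hz : f z = 1) (x : G) (i : ℕ) :
    f (x * z ^ i) = f x + i := by
  induction i with
  | zero => simp
  | succ i ih => rw [pow_succ, ← mul_assoc, hf, ih, hz, map_one]; push_cast; ring

/-! ### Trace-one elements of the extended algebra. -/

section Trace

variable [Fintype G] [Fintype Q] [CharP R p] (h : IsCentralExtension p q z) (hz : f z = 1)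
include h hz

omit [Fintype Q] in
-- On a fibre of q the values of f run through f(x) + i for i < p, so the sum is −x(u) ∑ (X + f(x) +
-- i)^(p−1) and the power sum contributes −1.
lemma sum_extAction_fiber [DecidableEq Q] (u : R) (x : G) :
    ∑ g with q g = q x, extAction q σ f hf g (-(C u * X ^ (p - 1))) = C (σ (q x) u) := by
  rw [h.sum_fiber]
  have : ∀ i : ℕ, extAction q σ f hf (x * z ^ i) (-(C u * X ^ (p - 1)))
      = -C (σ (q x) u) * (X + C (f x) + (i : R[X])) ^ (p - 1) := by
    intro i
    rw [map_neg, map_mul (extAction q σ f hf _), map_pow (extAction q σ f hf _), extAction_C,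
      extAction_X, h.map_mul_pow, cocycle_mul_pow hf hz, C_add, C_eq_natCast, neg_mul, add_assoc]
  simp_rw [this]
  rw [← Finset.mul_sum, sum_add_natCast_pow_sub_one]
  ring

lemma sum_extAction {u : R} (hu : ∑ y, σ y u = 1) :
    ∑ g, extAction q σ f hf g (-(C u * X ^ (p - 1))) = 1 := by
  classical
  rw [← Finset.sum_fiberwise Finset.univ q]
  have : ∀ y, ∑ g with q g = y, extAction q σ f hf g (-(C u * X ^ (p - 1))) = C (σ y u) := by
    intro y
    obtain ⟨x, rfl⟩ := h.surjective y
    exact sum_extAction_fiber hf h hz u x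
  simp_rw [this]
  rw [← map_sum, hu, map_one]

/-- Shows that the general solution formula for g t = t + f(g), applied with this trace-one element,
recovers X up to a prime-field constant. On each fibre one writes f(x) + i = (X + f(x) + i) − X to
reduce to power sums of exponents p and p − 1. -/
lemma sum_cocycle_mul_extAction {u : R} (hu : ∑ y, σ y u = 1) :
    -∑ g, C (f g) * extAction q σ f hf g (-(C u * X ^ (p - 1)))
      = X + ∑ i ∈ Finset.range p, (i : R[X]) := by
  classical
  rw [← Finset.sum_fiberwise Finset.univ q]
  have : ∀ y, ∑ g with q g = y, C (f g) * extAction q σ f hf g (-(C u * X ^ (p - 1)))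
      = -(C (σ y u) * (X + ∑ i ∈ Finset.range p, (i : R[X]))) := by
    intro y
    obtain ⟨x, rfl⟩ := h.surjective y
    rw [h.sum_fiber]
    have hp : p - 1 + 1 = p := Nat.sub_add_cancel (Fact.out : p.Prime).one_le
    have : ∀ i : ℕ, C (f (x * z ^ i)) * extAction q σ f hf (x * z ^ i) (-(C u * X ^ (p - 1)))
        = -C (σ (q x) u) * ((X + C (f x) + (i : R[X])) ^ p
          - X * (X + C (f x) + (i : R[X])) ^ (p - 1)) := by
      intro i
      rw [map_neg, map_mul (extAction q σ f hf _), map_pow (extAction q σ f hf _), extAction_C,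
        extAction_X, h.map_mul_pow, cocycle_mul_pow hf hz, C_add, C_eq_natCast]
      conv_rhs => rw [← hp]
      rw [pow_succ]
      simp only [Nat.add_sub_cancel]
      ring
    simp_rw [this]
    rw [← Finset.mul_sum, Finset.sum_sub_distrib, ← Finset.mul_sum, sum_add_natCast_pow_sub_one,
      sum_add_natCast_pow]
    ring
  simp_rw [this]
  rw [Finset.sum_neg_distrib, neg_neg, ← Finset.sum_mul, ← map_sum, hu, map_one, one_mul]

end Trace

/-! ### Invariants of the extended algebra via an Artin–Schreier polynomial. -/

section Invariants

variable [CharP R p] (h : IsCentralExtension p q z) (hz : f z = 1)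

include hf h hz in
-- The cocycle f^p − f does not change when f shifts by an element of the prime field, so it
-- descends to Q, where the trace-one element makes it a coboundary. This is what makes X^p − X − w
-- invariant.
lemma exists_artinSchreier_correction [Fintype Q] {u : R} (hu : ∑ y, σ y u = 1) :
    ∃ w : R, ∀ g, σ (q g) w = w + (f g ^ p - f g) := by
  let s := Function.surjInv h.surjective
  have hs : ∀ x, q x = q (s (q x)) := fun x => (Function.surjInv_eq h.surjective _).symm
  have hF : ∀ x, f (s (q x)) ^ p - f (s (q x)) = f x ^ p - f x := by
    intro x
    obtain ⟨i, -, hi⟩ := h.exists_pow (hs x)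
    have hi' : (i : R) ^ p = i := by
      rw [← Nat.cast_pow, ← map_natCast (ZMod.castHom dvd_rfl R), Nat.cast_pow, ZMod.pow_card,
        map_natCast]
    rw [← hi, cocycle_mul_pow hf hz, add_pow_char, hi']
    ring
  refine ⟨_, fun g => ((action_neg_sum_cocycle σ hu
    (F := fun y => f (s y) ^ p - f (s y)) ?_) (q g)).trans (by rw [hF])⟩
  intro y y'
  obtain ⟨x, rfl⟩ := h.surjective y
  obtain ⟨x', rfl⟩ := h.surjective y'
  rw [← map_mul, hF, hF, hF, hf, add_pow_char, map_sub, map_pow]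
  ring

variable {w : R} (hw : ∀ g, σ (q g) w = w + (f g ^ p - f g))

/-- The Artin–Schreier polynomial `X ^ p - X - w`. -/
def artinSchreier (p : ℕ) (w : R) : R[X] := X ^ p - (X + C w)

omit [CharP R p] in
lemma degree_artinSchreier [Nontrivial R] : (artinSchreier p w).degree = p := by
  have hp := (Fact.out : p.Prime).one_lt
  rw [artinSchreier, degree_sub_eq_left_of_degree_lt, degree_X_pow]
  rw [degree_X_pow, degree_X_add_C]
  exact_mod_cast hp

omit [CharP R p] in
lemma monic_artinSchreier : (artinSchreier p w).Monic := by
  nontriviality R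
  have hp := (Fact.out : p.Prime).one_lt
  refine monic_X_pow_sub ?_
  rw [degree_X_add_C]
  exact_mod_cast hp

include hw in
lemma extAction_artinSchreier (g : G) :
    extAction q σ f hf g (artinSchreier p w) = artinSchreier p w := by
  rw [artinSchreier, map_sub, map_pow, map_add, extAction_X, extAction_C, hw, add_pow_char]
  simp only [C_add, C_sub, C_pow]
  ring

/-- Substituting the Artin–Schreier polynomial into polynomials with invariant coefficients. -/
def artinSchreierHom (σ : Q →* (R →ₐ[k] R)) (p : ℕ) (w : R) : (invariants σ)[X] →ₐ[k] R[X] :=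
  aevalTower ((CAlgHom (R := k)).comp (invariants σ).val) (artinSchreier p w)

omit [Fact p.Prime] [CharP R p] in
lemma artinSchreierHom_C (c : invariants σ) : artinSchreierHom σ p w (C c) = C (c : R) := by
  simp [artinSchreierHom]

omit [Fact p.Prime] [CharP R p] in
lemma artinSchreierHom_X : artinSchreierHom σ p w X = artinSchreier p w := by
  simp [artinSchreierHom]

omit [CharP R p] in
lemma artinSchreierHom_injective [IsDomain R] :
    Function.Injective (artinSchreierHom σ p w) := by
  rw [injective_iff_map_eq_zero]
  intro P hP
  have h1 : artinSchreierHom σ p w P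
      = (P.map ((invariants σ).val : invariants σ →+* R)).comp (artinSchreier p w) := by
    rw [comp, eval₂_map]; rfl
  rw [h1, comp_eq_zero_iff] at hP
  rcases hP with hP | ⟨-, hP⟩
  · exact (Polynomial.map_eq_zero_iff Subtype.val_injective).1 hP
  · exfalso
    have h2 := degree_artinSchreier (p := p) (w := w)
    rw [hP] at h2
    have h3 := (Fact.out : p.Prime).pos
    have h4 := h2 ▸ (degree_C_le (a := (artinSchreier p w).coeff 0))
    exact absurd h3 (by exact_mod_cast h4.not_gt)

include h hz in
/-- Invariant polynomials of degree less than `p` are constant. -/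
lemma eq_C_of_extAction_eq [IsDomain R] {P : R[X]} (hP : P.degree < p)
    (hinv : extAction q σ f hf z P = P) : P = C (P.eval 0) := by
  -- Invariance under z reads P(X + 1) = P(X). Hence P − P(0) vanishes at the p distinct elements 0,
  -- …, p − 1, too many for its degree.
  have h1 : ∀ i : ℕ, P.eval (i : R) = P.eval 0 := by
    intro i
    induction i with
    | zero => simp
    | succ i ih =>
      rw [← ih]
      conv_rhs => rw [← hinv, extAction_apply, h.map_gen, hz, map_one]
      rw [eval_comp]
      have : P.map ((1 : R →ₐ[k] R) : R →+* R) = P := Polynomial.map_id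
      rw [this]
      simp
  rw [← sub_eq_zero]
  have hdeg : (P - C (P.eval 0)).degree < (Finset.univ : Finset (Fin p)).card := by
    rw [Finset.card_univ, Fintype.card_fin]
    refine (degree_sub_le _ _).trans_lt (max_lt hP ?_)
    refine degree_C_le.trans_lt ?_
    exact_mod_cast (Fact.out : p.Prime).pos
  refine eq_zero_of_degree_lt_of_eval_index_eq_zero (v := fun i : Fin p => ((i : ℕ) : R)) _ ?_
    hdeg fun i _ => ?_
  · intro i _ j _ hij
    exact Fin.ext (CharP.natCast_injOn_Iio R p i.2 j.2 hij)
  · rw [eval_sub, eval_C, h1, sub_self]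

include h hz hw in
-- Divide an invariant P by the monic invariant X^p − X − w. The action does not raise degrees, so
-- uniqueness of division makes quotient and remainder invariant; the remainder is a constant in
-- R^Q, and induction on the degree handles the quotient.
lemma range_artinSchreierHom [IsDomain R] :
    (artinSchreierHom σ p w).range = invariants (extAction q σ f hf) := by
  apply le_antisymm
  · rintro _ ⟨P, rfl⟩ g
    have : (extAction q σ f hf g).comp (artinSchreierHom σ p w) = artinSchreierHom σ p w := by
      apply Polynomial.algHom_ext'
      · ext c : 1
        change extAction q σ f hf g (artinSchreierHom σ p w (C c)) = artinSchreierHom σ p w (C c)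
        rw [artinSchreierHom_C, extAction_C, c.2]
      · rw [AlgHom.comp_apply, artinSchreierHom_X, extAction_artinSchreier hf hw]
    exact DFunLike.congr_fun this P
  · intro P hP
    have hmon := monic_artinSchreier (p := p) (w := w)
    have hdeg := degree_artinSchreier (p := p) (w := w)
    have hpos := (Fact.out : p.Prime).pos
    induction hd : P.natDegree using Nat.strong_induction_on generalizing P with
    | _ d ih =>
    have hdm : ∀ g, P /ₘ artinSchreier p w = extAction q σ f hf g (P /ₘ artinSchreier p w) ∧
        P %ₘ artinSchreier p w = extAction q σ f hf g (P %ₘ artinSchreier p w) := by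
      intro g
      refine div_modByMonic_unique _ _ hmon ⟨?_, ?_⟩
      · conv_rhs => rw [← hP g, ← modByMonic_add_div P (artinSchreier p w)]
        rw [map_add, map_mul, extAction_artinSchreier hf hw]
      · exact (degree_extAction_le hf g _).trans_lt (degree_modByMonic_lt _ hmon)
    have hC := eq_C_of_extAction_eq hf h hz
      (hdeg ▸ degree_modByMonic_lt P hmon) (hdm z).2.symm
    set c := (P %ₘ artinSchreier p w).eval 0
    have hc : c ∈ invariants σ := by
      intro y
      obtain ⟨x, rfl⟩ := h.surjective y
      have := (hdm x).2
      rw [hC, extAction_C] at this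
      exact (C_injective this).symm
    have hQ : P /ₘ artinSchreier p w ∈ (artinSchreierHom σ p w).range := by
      by_cases hlt : P.natDegree < p
      · rw [(divByMonic_eq_zero_iff hmon).2]
        · exact zero_mem _
        · rw [hdeg]
          exact degree_le_natDegree.trans_lt (by exact_mod_cast hlt)
      · refine ih _ ?_ (fun g => (hdm g).1.symm) rfl
        rw [natDegree_divByMonic _ hmon, natDegree_eq_of_degree_eq_some hdeg]
        omega
    rw [← modByMonic_add_div P (artinSchreier p w), hC]
    exact add_mem ⟨C ⟨c, hc⟩, artinSchreierHom_C _⟩ (mul_mem ⟨X, artinSchreierHom_X⟩ hQ)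

include h hz in
lemma nonempty_invariants_extAction_equiv [Fintype Q] [IsDomain R] {u : R}
    (hu : ∑ y, σ y u = 1) {n : ℕ} (e : invariants σ ≃ₐ[k] MvPolynomial (Fin n) k) :
    Nonempty (invariants (extAction q σ f hf) ≃ₐ[k] MvPolynomial (Fin (n + 1)) k) := by
  obtain ⟨w, hw⟩ := exists_artinSchreier_correction hf h hz hu
  exact ⟨((Subalgebra.equivOfEq _ _ (range_artinSchreierHom hf h hz hw).symm).trans
    (AlgEquiv.ofInjective _ artinSchreierHom_injective).symm).trans (snocEquiv n e.symm).symm⟩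

end Invariants

end Extension

/-! ### Existence of standard subalgebras -/

section Existence

open Polynomial

/-- A trace-surjective triangular polynomial algebra with polynomial invariants that is a retract
of `Dehom k G`. -/
structure StandardModel (k : Type u) [Field k] (G : Type u) [Group G] [Fintype G] (n : ℕ) where
  /-- the algebra -/
  R : Type u
  [commRing : CommRing R]
  [algebra : Algebra k R]
  /-- the action -/
  action : G →* (R →ₐ[k] R)
  traceSurjective : IsTraceSurjective action
  triangular : IsTriangular n action
  invariants_polynomial : Nonempty (invariants action ≃ₐ[k] MvPolynomial (Fin n) k)
  /-- the section of the retraction -/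
  ι : R →ₐ[k] Dehom k G
  /-- the retraction -/
  π : Dehom k G →ₐ[k] R
  ι_equivariant : IsEquivariant action (dehomAction k G) ι
  π_equivariant : IsEquivariant (dehomAction k G) action π
  π_ι : ∀ r, π (ι r) = r

attribute [instance] StandardModel.commRing StandardModel.algebra

variable {k : Type u} [Field k]

lemma nonempty_standardModel_of_subsingleton (G : Type u) [Group G] [Fintype G] [Subsingleton G] :
    Nonempty (StandardModel k G 0) := by
  let σ : G →* (k →ₐ[k] k) := 1
  have hsum : ∑ g : G, σ g 1 = 1 := by
    rw [Fintype.sum_subsingleton _ (1 : G)]; rfl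
  have htop : invariants σ = ⊤ := by
    rw [eq_top_iff]
    intro r _ g
    rfl
  refine ⟨{
    R := k
    action := σ
    traceSurjective := isTraceSurjective_iff.2 ⟨1, hsum⟩
    triangular := ⟨MvPolynomial.isEmptyAlgEquiv k (Fin 0), fun _ i => i.elim0⟩
    invariants_polynomial := ⟨((Subalgebra.equivOfEq _ _ htop).trans Subalgebra.topEquiv).trans
      (MvPolynomial.isEmptyAlgEquiv k (Fin 0)).symm⟩
    ι := Algebra.ofId k _
    π := dehomLift (fun g => σ g 1) hsum
    ι_equivariant := fun g r => ((dehomAction k G g).commutes r).symm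
    π_equivariant := isEquivariant_dehomLift σ hsum
    π_ι := fun r => ?_ }⟩
  exact (dehomLift (fun g => σ g 1) hsum).commutes r

variable {G Q : Type u} [Group G] [Group Q] [Fintype G] [Fintype Q]

/-- The map `Dehom k Q → Dehom k G` sending `X_y` to the sum of the `X_g` with `g` over `y`. -/
def dehomPullback (k : Type u) [Field k] [DecidableEq Q] (q : G →* Q) :
    Dehom k Q →ₐ[k] Dehom k G :=
  dehomLift (fun y => ∑ g with q g = y, dehomX k g) (by
    rw [Finset.sum_fiberwise, sum_dehomX])

lemma dehomPullback_action [DecidableEq Q] (q : G →* Q) (g : G) (r : Dehom k Q) :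
    dehomPullback k q (dehomAction k Q (q g) r) = dehomAction k G g (dehomPullback k q r) := by
  refine DFunLike.congr_fun (f := (dehomPullback k q).comp (dehomAction k Q (q g)))
    (g := (dehomAction k G g).comp (dehomPullback k q)) (dehom_algHom_ext fun y => ?_) r
  simp only [AlgHom.comp_apply, dehomAction_dehomX, dehomPullback, dehomLift_dehomX, map_sum]
  refine Finset.sum_bij' (fun x _ => g⁻¹ * x) (fun x _ => g * x) ?_ ?_ ?_ ?_ ?_
  · intro x hx
    simp [(Finset.mem_filter.1 hx).2]
  · intro x hx
    simp [(Finset.mem_filter.1 hx).2]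
  all_goals simp

/-- The retract for Q extends to R[X]: π sends X_g to g(a) for the trace-one element a of R[X],
while ι is the pulled-back section on R and sends X to a solution t in D of the same cocycle
equation that X satisfies. -/
lemma nonempty_standardModel_succ {p n : ℕ} [Fact p.Prime] [CharP k p] {q : G →* Q} {z : G}
    (h : IsCentralExtension p q z) (M : StandardModel k Q n) :
    Nonempty (StandardModel k G (n + 1)) := by
  classical
  obtain ⟨e, -⟩ := id M.triangular
  have : IsDomain M.R := e.symm.injective.isDomain e.symm.toRingEquiv.toRingHom
  have : CharP M.R p := charP_of_injective_algebraMap (algebraMap k M.R).injective p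
  -- Taking this trace-one element, rather than an arbitrary one, makes the fibre sums of g(a) agree
  -- with the old retraction, so that π ∘ j is the inclusion of constants.
  set u := M.π (dehomX k 1)
  have hπ : ∀ y, M.π (dehomX k y) = M.action y u := fun y => by
    rw [← M.π_equivariant, dehomAction_dehomX, mul_one]
  have hu : ∑ y, M.action y u = 1 := by
    simp_rw [← hπ]
    rw [← map_sum, sum_dehomX, map_one]
  obtain ⟨f, hf, hz⟩ := h.exists_cocycle M.action hu
  let τ := extAction q M.action f hf
  obtain ⟨a, ha, hfib, hcob⟩ : ∃ a, ∑ g, τ g a = 1 ∧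
      (∀ x, ∑ g with q g = q x, τ g a = C (M.action (q x) u)) ∧
      -∑ g, C (f g) * τ g a = X + ∑ i ∈ Finset.range p, (i : M.R[X]) :=
    ⟨_, sum_extAction hf h hz hu, sum_extAction_fiber hf h hz u,
      sum_cocycle_mul_extAction hf h hz hu⟩
  let π : Dehom k G →ₐ[k] M.R[X] := dehomLift (fun g => τ g a) ha
  let j : M.R →ₐ[k] Dehom k G := (dehomPullback k q).comp M.ι
  have hj : ∀ g r, j (M.action (q g) r) = dehomAction k G g (j r) := fun g r => by
    rw [AlgHom.comp_apply, M.ι_equivariant, dehomPullback_action]; rfl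
  have hπj : ∀ r, π (j r) = C r := by
    intro r
    have h1 : π.comp (dehomPullback k q) = (CAlgHom (R := k)).comp M.π := by
      refine dehom_algHom_ext fun y => ?_
      obtain ⟨x, rfl⟩ := h.surjective y
      simp only [AlgHom.comp_apply, dehomPullback, dehomLift_dehomX, map_sum, π, hπ]
      exact hfib x
    have h2 := DFunLike.congr_fun h1 (M.ι r)
    simp only [AlgHom.comp_apply, M.π_ι] at h2
    exact h2
  -- The subtracted integer is the constant left over by `sum_cocycle_mul_extAction`. It is
  -- invariant, so the cocycle equation still holds, and now π t = X exactly.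
  let t : Dehom k G := -∑ g, j (f g) * dehomAction k G g (dehomX k 1)
    - ∑ i ∈ Finset.range p, (i : Dehom k G)
  have ht : ∀ g, dehomAction k G g t = t + j (f g) := by
    intro g
    have h1 := action_neg_sum_cocycle (dehomAction k G) sum_dehomAction_dehomX_one
      (F := fun g => j (f g)) (fun g g' => by rw [hf, map_add, hj]) g
    simp only [t]
    rw [map_sub, h1]
    simp only [map_sum, map_natCast]
    ring
  have hπt : π t = X := by
    have h1 : ∀ g, π (dehomX k g) = τ g a := fun g => dehomLift_dehomX _ _ g
    simp only [t, map_sub, map_neg, map_sum, map_mul, map_natCast, hπj, dehomAction_dehomX,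
      mul_one, h1]
    rw [hcob, add_sub_cancel_right]
  refine ⟨{
    R := M.R[X]
    action := τ
    traceSurjective := isTraceSurjective_iff.2 ⟨_, ha⟩
    triangular := isTriangular_extAction hf M.triangular
    invariants_polynomial :=
      M.invariants_polynomial.elim (nonempty_invariants_extAction_equiv hf h hz hu)
    ι := aevalTower j t
    π := π
    ι_equivariant := fun g r => ?_
    π_equivariant := isEquivariant_dehomLift τ ha
    π_ι := fun r => ?_ }⟩
  · refine DFunLike.congr_fun (f := (aevalTower j t).comp (τ g))
      (g := (dehomAction k G g).comp (aevalTower j t)) (Polynomial.algHom_ext' ?_ ?_) r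
    · ext c
      simp [τ, hj]
    · simp [τ, ht]
  · refine DFunLike.congr_fun (f := π.comp (aevalTower j t)) (g := AlgHom.id k _)
      (Polynomial.algHom_ext' ?_ ?_) r
    · ext c : 1
      simp [hπj]
    · simp [hπt]

/-- A nontrivial p-group has nontrivial centre, and Cauchy's theorem supplies a central z of order
p. -/
lemma exists_isCentralExtension {p n : ℕ} [Fact p.Prime] (hG : Fintype.card G = p ^ (n + 1)) :
    ∃ (Q : Type u) (_ : Group Q) (_ : Fintype Q) (q : G →* Q) (z : G),
      IsCentralExtension p q z ∧ Fintype.card Q = p ^ n := by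
  classical
  have hpG : IsPGroup p G := IsPGroup.of_card (n := n + 1) (by rw [Nat.card_eq_fintype_card, hG])
  have : Nontrivial G := by
    rw [← Fintype.one_lt_card_iff_nontrivial, hG]
    exact Nat.one_lt_pow n.succ_ne_zero (Fact.out : p.Prime).one_lt
  have := hpG.center_nontrivial
  obtain ⟨m, hm, hcard⟩ := (hpG.to_subgroup (Subgroup.center G)).nontrivial_iff_card.1 this
  obtain ⟨z, hz⟩ := exists_prime_orderOf_dvd_card' (G := Subgroup.center G) p
    (hcard ▸ dvd_pow_self p hm.ne')
  have hz' : orderOf (z : G) = p := by rw [← hz, Subgroup.orderOf_coe]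
  have hcomm : ∀ x, (z : G) * x = x * z := fun x => (Subgroup.mem_center_iff.1 z.2 x).symm
  have hn : (Subgroup.zpowers (z : G)).Normal := by
    refine ⟨fun x hx g => ?_⟩
    have hxc : x ∈ Subgroup.center G := (Subgroup.zpowers_le.2 z.2) hx
    rwa [Subgroup.mem_center_iff.1 hxc g, mul_inv_cancel_right]
  refine ⟨G ⧸ Subgroup.zpowers (z : G), inferInstance, inferInstance, QuotientGroup.mk' _, z,
    ⟨QuotientGroup.mk'_surjective _, hcomm, QuotientGroup.ker_mk' _, hz'⟩, ?_⟩
  have h1 := Subgroup.card_eq_card_quotient_mul_card_subgroup (Subgroup.zpowers (z : G))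
  rw [Nat.card_zpowers, hz', Nat.card_eq_fintype_card, hG, pow_succ, Nat.card_eq_fintype_card] at h1
  exact (Nat.eq_of_mul_eq_mul_right (Fact.out : p.Prime).pos h1).symm

lemma nonempty_standardModel {p : ℕ} [Fact p.Prime] [CharP k p] (n : ℕ) :
    ∀ (G : Type u) [Group G] [Fintype G], Fintype.card G = p ^ n →
      Nonempty (StandardModel k G n) := by
  induction n with
  | zero =>
    intro G _ _ hG
    have : Subsingleton G := (Fintype.card_le_one_iff_subsingleton).1 (by rw [hG, pow_zero])
    exact nonempty_standardModel_of_subsingleton G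
  | succ n ih =>
    intro G _ _ hG
    obtain ⟨Q, _, _, q, z, h, hQ⟩ := exists_isCentralExtension hG
    obtain ⟨M⟩ := ih Q hQ
    exact nonempty_standardModel_succ h M

/-- U is the image of ι, with all structure transported along R ≅ U, and the stable complement is
the kernel of π. -/
lemma StandardModel.exists_isStandard {n : ℕ} (M : StandardModel k G n) :
    ∃ U : Subalgebra k (Dehom k G), IsStandard n U := by
  have hinj : Function.Injective M.ι := Function.LeftInverse.injective M.π_ι
  let E : M.R ≃ₐ[k] M.ι.range := AlgEquiv.ofInjective M.ι hinj
  have hst : IsStable (dehomAction k G) M.ι.range := by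
    rintro g _ ⟨r, rfl⟩
    exact ⟨M.action g r, M.ι_equivariant g r⟩
  have hE : ∀ g r, restrictAction (dehomAction k G) M.ι.range hst g (E r) = E (M.action g r) :=
    fun g r => Subtype.ext (M.ι_equivariant g r).symm
  refine ⟨M.ι.range, hst, ?_, ?_, ?_, ?_⟩
  · obtain ⟨u, hu⟩ := isTraceSurjective_iff.1 M.traceSurjective
    refine isTraceSurjective_iff.2 ⟨E u, ?_⟩
    simp_rw [hE]
    rw [← map_sum, hu, map_one]
  · obtain ⟨e, he⟩ := M.triangular
    refine ⟨e.trans E, fun g i => ?_⟩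
    obtain ⟨f, hf, hg⟩ := he g i
    refine ⟨f, hf, ?_⟩
    simp only [AlgEquiv.trans_apply]
    rw [hE, hg, map_add]
  · obtain ⟨e⟩ := M.invariants_polynomial
    have hmap : (invariants M.action).map (E : M.R →ₐ[k] M.ι.range)
        = invariants (restrictAction (dehomAction k G) M.ι.range hst) := by
      ext x
      constructor
      · rintro ⟨r, hr, rfl⟩ g
        exact (hE g r).trans (congrArg E (hr g))
      · intro hx
        refine ⟨E.symm x, fun g => E.injective ?_, E.apply_symm_apply x⟩
        rw [← hE, E.apply_symm_apply]
        exact hx g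
    exact ⟨((Subalgebra.equivOfEq _ _ hmap.symm).trans
      ((invariants M.action).equivMapOfInjective _ E.injective).symm).trans e⟩
  · refine ⟨RingHom.ker M.π, fun g x hx => ?_, ?_⟩
    · rw [RingHom.mem_ker] at hx ⊢
      rw [M.π_equivariant, hx, map_zero]
    · rw [isCompl_iff, Submodule.disjoint_def, codisjoint_iff, eq_top_iff]
      constructor
      · rintro _ ⟨r, rfl⟩ hx
        have : M.π (M.ι r) = 0 := hx
        rw [M.π_ι] at this
        rw [this]
        exact map_zero M.ι
      · intro x _
        rw [← add_sub_cancel (M.ι (M.π x)) x]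
        refine Submodule.add_mem_sup ⟨_, rfl⟩ ?_
        change M.π (x - M.ι (M.π x)) = 0
        rw [map_sub, M.π_ι, sub_self]

end Existence

/-! ### Functions on schemes with a group action -/

section Functions

variable {k : Type u} [Field k] {G : Type u} [Group G]

/-- The global functions on a scheme over `k` form a `k`-algebra. -/
abbrev functionsAlgebra (Y : Over (Spec (CommRingCat.of k))) : Algebra k Γ(Y.left, ⊤) :=
  (constants Y).hom.toAlgebra

attribute [local instance] functionsAlgebra

lemma constants_comp_appTop {Y Z : Over (Spec (CommRingCat.of k))} (f : Y ⟶ Z) :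
    constants Z ≫ f.left.appTop = constants Y := by
  rw [constants, constants, Category.assoc, ← Scheme.Hom.comp_appTop, Over.w]

/-- Pullback of functions along a morphism over `k`. -/
def pullbackFunctions {Y Z : Over (Spec (CommRingCat.of k))} (f : Y ⟶ Z) :
    Γ(Z.left, ⊤) →ₐ[k] Γ(Y.left, ⊤) where
  __ := f.left.appTop.hom
  commutes' c := congrArg (fun φ => φ.hom c) (constants_comp_appTop f)

lemma pullbackFunctions_apply {Y Z : Over (Spec (CommRingCat.of k))} (f : Y ⟶ Z)
    (s : Γ(Z.left, ⊤)) : pullbackFunctions f s = f.left.appTop.hom s := rfl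

lemma pullbackFunctions_id (Y : Over (Spec (CommRingCat.of k))) :
    pullbackFunctions (𝟙 Y) = AlgHom.id k _ := by
  ext s
  rw [pullbackFunctions_apply, Over.id_left, Scheme.Hom.id_appTop]
  rfl

lemma pullbackFunctions_comp {X Y Z : Over (Spec (CommRingCat.of k))} (f : X ⟶ Y) (g : Y ⟶ Z) :
    pullbackFunctions (f ≫ g) = (pullbackFunctions f).comp (pullbackFunctions g) := by
  ext s
  rw [pullbackFunctions_apply, Over.comp_left, Scheme.Hom.comp_appTop]
  rfl

/-- The left action of `G` on the functions on a scheme with `G`-action. -/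
def functionAction (Y : Action (Over (Spec (CommRingCat.of k))) G) :
    G →* (Γ(Y.V.left, ⊤) →ₐ[k] Γ(Y.V.left, ⊤)) where
  toFun g := pullbackFunctions (act Y g⁻¹)
  map_one' := by
    rw [act, inv_one, map_one]
    exact pullbackFunctions_id _
  map_mul' g h := by
    rw [act, mul_inv_rev, map_mul]
    exact pullbackFunctions_comp (act Y g⁻¹) (act Y h⁻¹)

lemma functionAction_inv_apply (Y : Action (Over (Spec (CommRingCat.of k))) G) (g : G)
    (s : Γ(Y.V.left, ⊤)) : functionAction Y g⁻¹ s = (act Y g).left.appTop.hom s := by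
  change (act Y g⁻¹⁻¹).left.appTop.hom s = _
  rw [inv_inv]

lemma isEquivariant_pullbackFunctions {Y Z : Action (Over (Spec (CommRingCat.of k))) G}
    (f : Y ⟶ Z) :
    IsEquivariant (functionAction Z) (functionAction Y) (pullbackFunctions f.hom) := by
  intro g s
  have h : pullbackFunctions (act Y g⁻¹ ≫ f.hom) = pullbackFunctions (f.hom ≫ act Z g⁻¹) := by
    rw [act, act, f.comm]
  rw [pullbackFunctions_comp, pullbackFunctions_comp] at h
  exact (DFunLike.congr_fun h s).symm

lemma mem_invariantFunctions_iff {Y : Action (Over (Spec (CommRingCat.of k))) G}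
    {s : Γ(Y.V.left, ⊤)} : s ∈ invariantFunctions Y ↔ s ∈ invariants (functionAction Y) := by
  exact ⟨fun h g => h g⁻¹, fun h g => (functionAction_inv_apply Y g s).symm.trans (h g⁻¹)⟩

variable {R : Type u} [CommRing R] [Algebra k R] (σ : G →* (R →ₐ[k] R))

/-- The isomorphism of an algebra with the functions on its spectrum. -/
def specFunctions : R ≃ₐ[k] Γ((specAction σ).V.left, ⊤) where
  __ := (Scheme.ΓSpecIso (CommRingCat.of R)).commRingCatIsoToRingEquiv.symm
  commutes' c := by
    have := Scheme.ΓSpecIso_inv_naturality (CommRingCat.ofHom (algebraMap k R))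
    exact congrArg (fun φ => φ.hom c) this

lemma functionAction_specFunctions (g : G) (r : R) :
    functionAction (specAction σ) g (specFunctions σ r) = specFunctions σ (σ g r) := by
  have h := Scheme.ΓSpecIso_inv_naturality (CommRingCat.ofHom (σ g⁻¹⁻¹).toRingHom)
  have h2 : functionAction (specAction σ) g (specFunctions σ r) = specFunctions σ (σ g⁻¹⁻¹ r) :=
    (congrArg (fun φ => φ.hom r) h).symm
  rw [h2, inv_inv]

lemma specFunctions_trace [Fintype G] {u : R} (hu : ∑ g, σ g u = 1) :
    ∑ g, functionAction (specAction σ) g (specFunctions σ u) = 1 := by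
  simp_rw [functionAction_specFunctions]
  rw [← map_sum, hu, map_one]

variable {σ} {Y : Action (Over (Spec (CommRingCat.of k))) G}

/-- The morphism to a spectrum given by a homomorphism of `k-G` algebras. -/
def toSpecAction (φ : R →ₐ[k] Γ(Y.V.left, ⊤)) (hφ : IsEquivariant σ (functionAction Y) φ) :
    Y ⟶ specAction σ where
  hom := Over.homMk (Y.V.left.toSpecΓ ≫ Spec.map (CommRingCat.ofHom φ.toRingHom)) (by
    change (_ ≫ Spec.map _) ≫ Spec.map (CommRingCat.ofHom (algebraMap k R)) = Y.V.hom
    have h : CommRingCat.ofHom (algebraMap k R) ≫ CommRingCat.ofHom φ.toRingHom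
        = constants Y.V := by
      ext c; exact φ.commutes c
    rw [Category.assoc, ← Spec.map_comp, h, constants, Spec.map_comp,
      ← Scheme.toSpecΓ_naturality_assoc]
    simp)
  comm g := by
    apply Over.OverMorphism.ext
    change (act Y g).left ≫ Y.V.left.toSpecΓ ≫ Spec.map (CommRingCat.ofHom φ.toRingHom)
      = (Y.V.left.toSpecΓ ≫ Spec.map (CommRingCat.ofHom φ.toRingHom)) ≫
        Spec.map (CommRingCat.ofHom (σ g⁻¹).toRingHom)
    rw [Scheme.toSpecΓ_naturality_assoc, Category.assoc, ← Spec.map_comp, ← Spec.map_comp]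
    congr 2
    ext r
    exact (functionAction_inv_apply Y g (φ r)).symm.trans (hφ g⁻¹ r).symm

lemma pullbackFunctions_toSpecAction (φ : R →ₐ[k] Γ(Y.V.left, ⊤))
    (hφ : IsEquivariant σ (functionAction Y) φ) (r : R) :
    pullbackFunctions (toSpecAction φ hφ).hom (specFunctions σ r) = φ r := by
  have h : (Y.V.left.toSpecΓ ≫ Spec.map (CommRingCat.ofHom φ.toRingHom)).appTop
      = (Scheme.ΓSpecIso (CommRingCat.of R)).hom ≫ CommRingCat.ofHom φ.toRingHom := by
    rw [Scheme.Hom.comp_appTop, Scheme.toSpecΓ_appTop, Scheme.ΓSpecIso_naturality]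
  have h2 : (Scheme.ΓSpecIso (CommRingCat.of R)).inv ≫
      (Y.V.left.toSpecΓ ≫ Spec.map (CommRingCat.ofHom φ.toRingHom)).appTop
      = CommRingCat.ofHom φ.toRingHom := by
    rw [h, Iso.inv_hom_id_assoc]
  exact congrArg (fun φ => φ.hom r) h2

end Functions

/-! ### Free actions, fibre products and closed embeddings -/

section Varieties

variable {k : Type u} [Field k] {G : Type u} [Group G]

attribute [local instance] functionsAlgebra

variable {Y Z : Action (Over (Spec (CommRingCat.of k))) G}

/-- Maximal ideals are the closed points of Y. Since g acts on functions through g⁻¹, an ideal fixed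
by g is a closed point fixed by g⁻¹. -/
lemma IsFree.comap_ne [IsAffine Y.V.left] (hY : IsFree Y) (g : G) (hg : g ≠ 1)
    (M : Ideal Γ(Y.V.left, ⊤)) (hM : M.IsMaximal) : M.comap (functionAction Y g) ≠ M := by
  intro h
  let x : PrimeSpectrum Γ(Y.V.left, ⊤) := ⟨M, hM.isPrime⟩
  let E := Scheme.homeoOfIso Y.V.left.isoSpec
  obtain ⟨y, hy⟩ := E.surjective x
  have hcl : IsClosed {y} := by
    have h1 : IsClosed {E y} := by
      rw [hy]; exact (PrimeSpectrum.isClosed_singleton_iff_isMaximal x).2 hM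
    have h2 : E '' {y} = {E y} := Set.image_singleton
    exact E.isClosed_image.1 (h2 ▸ h1)
  refine hY g⁻¹ (inv_ne_one.2 hg) y hcl (E.injective ?_)
  have hnat := Scheme.toSpecΓ_naturality (act Y g⁻¹).left
  have h2 : E ((act Y g⁻¹).left y) = (Spec.map (act Y g⁻¹).left.appTop) (E y) :=
    congrArg (fun f => f y) hnat
  rw [h2, hy]
  exact PrimeSpectrum.ext h

lemma IsFree.exists_trace_eq_one [Fintype G] [IsAffine Y.V.left] (hY : IsFree Y) :
    ∃ u, ∑ g, functionAction Y g u = 1 :=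
  exists_trace_eq_one_of_free _ hY.comap_ne

/-- The restriction of a pullback map to invariant functions. -/
def pullbackInvariants (f : Y ⟶ Z) : invariantFunctions Z →+* invariantFunctions Y :=
  ((pullbackFunctions f.hom : Γ(Z.V.left, ⊤) →+* Γ(Y.V.left, ⊤)).comp
    (invariantFunctions Z).subtype).codRestrict _ fun s => by
      refine mem_invariantFunctions_iff.2 fun g => ?_
      have := isEquivariant_pullbackFunctions f g s
      rw [mem_invariantFunctions_iff.1 s.2 g] at this
      exact this.symm

/-- The trace map from functions to invariant functions. -/
def functionTrace [Fintype G] (Y : Action (Over (Spec (CommRingCat.of k))) G) :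
    Γ(Y.V.left, ⊤) →ₗ[invariantFunctions Y] invariantFunctions Y where
  toFun s := ⟨∑ g, functionAction Y g s,
    mem_invariantFunctions_iff.2 (trace (functionAction Y) s).2⟩
  map_add' s t := by ext; simp [Finset.sum_add_distrib]
  map_smul' r s := by
    ext
    change ∑ g, functionAction Y g ((r : Γ(Y.V.left, ⊤)) * s)
      = (r : Γ(Y.V.left, ⊤)) * ∑ g, functionAction Y g s
    rw [Finset.mul_sum]
    exact Finset.sum_congr rfl fun g _ => by
      rw [map_mul, mem_invariantFunctions_iff.1 r.2 g]

/-- A trace-one function on Z alone is enough: its Galois coordinates pull back along f and give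
dual bases on Y as well. -/
lemma isPushout_pullbackFunctions [Fintype G] {p n : ℕ} [Fact p.Prime] [CharP k p]
    (hG : Fintype.card G = p ^ n) (f : Y ⟶ Z) {u : Γ(Z.V.left, ⊤)}
    (hu : ∑ g, functionAction Z g u = 1) :
    IsPushout (CommRingCat.ofHom (pullbackInvariants f))
      (CommRingCat.ofHom (invariantFunctions Z).subtype)
      (CommRingCat.ofHom (invariantFunctions Y).subtype) f.hom.left.appTop := by
  classical
  obtain ⟨m, x, y, hxy⟩ := exists_galois_coordinates hG _ hu
  let _ : Algebra (invariantFunctions Z) (invariantFunctions Y) := (pullbackInvariants f).toAlgebra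
  let φ : Γ(Z.V.left, ⊤) →+* Γ(Y.V.left, ⊤) := f.hom.left.appTop.hom
  let _ : Algebra Γ(Z.V.left, ⊤) Γ(Y.V.left, ⊤) := φ.toAlgebra
  let _ : Algebra (invariantFunctions Z) Γ(Y.V.left, ⊤) :=
    (φ.comp (invariantFunctions Z).subtype).toAlgebra
  have : IsScalarTower (invariantFunctions Z) Γ(Z.V.left, ⊤) Γ(Y.V.left, ⊤) :=
    IsScalarTower.of_algebraMap_eq fun _ => rfl
  have : IsScalarTower (invariantFunctions Z) (invariantFunctions Y) Γ(Y.V.left, ⊤) :=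
    IsScalarTower.of_algebraMap_eq fun _ => rfl
  have hequiv := isEquivariant_pullbackFunctions f
  have : Algebra.IsPushout (invariantFunctions Z) (invariantFunctions Y)
      Γ(Z.V.left, ⊤) Γ(Y.V.left, ⊤) := by
    refine isPushout_of_dual_bases (functionTrace Z) (functionTrace Y) ?_ x y ?_ ?_
    · intro s
      apply Subtype.ext
      change ∑ g, functionAction Y g (pullbackFunctions f.hom s)
        = pullbackFunctions f.hom (∑ g, functionAction Z g s)
      rw [map_sum]
      exact Finset.sum_congr rfl fun g _ => (hequiv g s).symm
    · exact sum_smul_galois_coordinates _ _ (φ := AlgHom.id k _) (fun _ _ => rfl) hxy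
    · exact sum_smul_galois_coordinates _ _ hequiv hxy
  exact CommRingCat.isPushout_of_isPushout (invariantFunctions Z) (invariantFunctions Y)
      Γ(Z.V.left, ⊤) Γ(Y.V.left, ⊤)

/-- The morphism of quotients induced by an equivariant morphism. -/
def mapQuotient (f : Y ⟶ Z) : quotient Y ⟶ quotient Z :=
  Over.homMk (Spec.map (CommRingCat.ofHom (pullbackInvariants f))) (by
    change Spec.map _ ≫ Spec.map _ = Spec.map _
    rw [← Spec.map_comp]
    congr 1
    ext c
    exact (pullbackFunctions f.hom).commutes c)

lemma isPullback_mapQuotient [Fintype G] {p n : ℕ} [Fact p.Prime] [CharP k p]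
    (hG : Fintype.card G = p ^ n) [IsAffine Y.V.left] [IsAffine Z.V.left] (f : Y ⟶ Z)
    {u : Γ(Z.V.left, ⊤)} (hu : ∑ g, functionAction Z g u = 1) :
    IsPullback (quotientMap Y) f.hom (mapQuotient f) (quotientMap Z) := by
  have h1 := isPullback_SpecMap_of_isPushout _ _ _ _ (isPushout_pullbackFunctions hG f hu)
  have h2 : IsPullback (quotientMap Y).left f.hom.left (mapQuotient f).left (quotientMap Z).left :=
    h1.of_iso Y.V.left.isoSpec.symm (Iso.refl _) Z.V.left.isoSpec.symm (Iso.refl _)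
      (by
        change _ ≫ 𝟙 _ = Y.V.left.isoSpec.inv ≫ Y.V.left.toSpecΓ ≫ _
        rw [Scheme.isoSpec_inv_toSpecΓ_assoc, Category.comp_id])
      (by exact (Scheme.isoSpec_inv_naturality f.hom.left))
      ((Category.comp_id _).trans (Category.id_comp (Spec.map _)).symm)
      (by
        change _ ≫ 𝟙 _ = Z.V.left.isoSpec.inv ≫ Z.V.left.toSpecΓ ≫ _
        rw [Scheme.isoSpec_inv_toSpecΓ_assoc, Category.comp_id])
  exact IsPullback.of_map (Over.forget _) (Over.OverMorphism.ext h2.w) h2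

lemma IsAffineVariety.finiteType_functions {X : Over (Spec (CommRingCat.of k))}
    (hX : IsAffineVariety X) : Algebra.FiniteType k Γ(X.left, ⊤) := by
  have := hX.affine
  have h1 : RingHom.FiniteType X.hom.appTop.hom :=
    (HasRingHomProperty.iff_of_isAffine (P := @LocallyOfFiniteType)).1 hX.finiteType
  have h2 : RingHom.FiniteType (Scheme.ΓSpecIso (CommRingCat.of k)).inv.hom :=
    RingHom.FiniteType.of_surjective _
      (Scheme.ΓSpecIso (CommRingCat.of k)).commRingCatIsoToRingEquiv.symm.surjective
  exact h1.comp h2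

/-- A morphism to a product of affine schemes over `k` is a closed immersion if the functions of
the factors generate the functions of the source. -/
lemma isClosedImmersion_of_iSup_range_eq_top {ι : Type*}
    {X P : Over (Spec (CommRingCat.of k))} {B : ι → Over (Spec (CommRingCat.of k))}
    [IsAffine X.left] [∀ i, IsAffine (B i).left] (π : ∀ i, P ⟶ B i)
    (hπ : ∀ (T : Over (Spec (CommRingCat.of k))) (a b : T ⟶ P), (∀ i, a ≫ π i = b ≫ π i) → a = b)
    (f : X ⟶ P) (hf : ⨆ i, (pullbackFunctions (f ≫ π i)).range = ⊤) :
    IsClosedImmersion f.left := by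
  have hsurj : Function.Surjective f.left.appTop := by
    have : (pullbackFunctions f).range = ⊤ := by
      rw [eq_top_iff, ← hf, iSup_le_iff]
      rintro i _ ⟨s, rfl⟩
      exact ⟨pullbackFunctions (π i) s, by rw [pullbackFunctions_comp]; rfl⟩
    exact AlgHom.range_eq_top _ |>.1 this
  -- Affineness of the product P is not presupposed. A morphism from P to an affine scheme factors
  -- through Spec Γ(P), and the projections to the Bᵢ and the structure map determine a map into P;
  -- hence P → Spec Γ(P) is a monomorphism, which can be cancelled from a closed immersion.
  have hfac : ∀ {W : Scheme.{u}} [IsAffine W] (h : P.left ⟶ W) {T : Scheme.{u}} (a b : T ⟶ P.left),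
      a ≫ P.left.toSpecΓ = b ≫ P.left.toSpecΓ → a ≫ h = b ≫ h := by
    intro W _ h T a b hab
    rw [← cancel_mono W.toSpecΓ, Category.assoc, Category.assoc, Scheme.toSpecΓ_naturality,
      reassoc_of% hab]
  have : Mono P.left.toSpecΓ := by
    refine ⟨fun {T} a b hab => ?_⟩
    have hw : b ≫ P.hom = a ≫ P.hom := (hfac P.hom a b hab).symm
    have := hπ (Over.mk (a ≫ P.hom)) (Over.homMk a) (Over.homMk b hw) fun i =>
      Over.OverMorphism.ext (hfac (π i).left a b hab)
    exact congrArg CommaMorphism.left this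
  have : IsClosedImmersion (f.left ≫ P.left.toSpecΓ) := by
    refine IsClosedImmersion.of_surjective_of_isAffine _ ?_
    rw [Scheme.Hom.comp_appTop, Scheme.toSpecΓ_appTop]
    exact hsurj.comp
      (Scheme.ΓSpecIso Γ(P.left, ⊤)).commRingCatIsoToRingEquiv.surjective
  exact IsClosedImmersion.of_comp f.left P.left.toSpecΓ

/-- Forgetting the action preserves limits, so the scheme underlying the equivariant product is the
product over k. -/
lemma prod_hom_ext {ι : Type} [Finite ι] (B : ι → Action (Over (Spec (CommRingCat.of k))) G)
    (T : Over (Spec (CommRingCat.of k))) (a b : T ⟶ (∏ᶜ B).V)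
    (h : ∀ i, a ≫ (Pi.π B i).hom = b ≫ (Pi.π B i).hom) : a = b := by
  have hl := isLimitOfPreserves (Action.forget (Over (Spec (CommRingCat.of k))) G)
    (limit.isLimit (Discrete.functor B))
  exact hl.hom_ext fun j => h j.as

end Varieties

/-! ### The trivial torsor -/

section TrivialTorsor

variable {k : Type u} [Field k] (G : Type u) [Group G]

attribute [local instance] functionsAlgebra

/-- Left translation on the functions from `G` to an algebra. -/
def translation (R : Type u) [CommRing R] [Algebra k R] : G →* ((G → R) →ₐ[k] (G → R)) where
  toFun g :=
    { toFun := fun f h => f (g⁻¹ * h)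
      map_one' := rfl
      map_mul' := fun _ _ => rfl
      map_zero' := rfl
      map_add' := fun _ _ => rfl
      commutes' := fun _ => rfl }
  map_one' := by ext; simp
  map_mul' g h := by
    ext f x
    change f ((g * h)⁻¹ * x) = f (h⁻¹ * (g⁻¹ * x))
    rw [mul_inv_rev, mul_assoc]

lemma translation_apply {R : Type u} [CommRing R] [Algebra k R] (g h : G) (f : G → R) :
    translation (k := k) G R g f h = f (g⁻¹ * h) := rfl

/-- A prime of the function ring G → R omits exactly one indicator idempotent, i.e. a point lies on
exactly one sheet of G × Spec R, and translation by g ≠ 1 moves the sheets without fixing any. -/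
lemma isFree_translation [Finite G] (R : Type u) [CommRing R] [Algebra k R] :
    IsFree (specAction (translation (k := k) G R)) := by
  classical
  have := Fintype.ofFinite G
  intro g hg y _ hy
  let P : Ideal (G → R) := (show PrimeSpectrum (G → R) from y).asIdeal
  have hP : P.IsPrime := (show PrimeSpectrum (G → R) from y).isPrime
  have hcomap : P.comap (translation (k := k) G R g⁻¹) = P :=
    congrArg PrimeSpectrum.asIdeal (show (_ : PrimeSpectrum (G → R)) = _ from hy)
  obtain ⟨h, hh⟩ : ∃ h : G, (Pi.single h 1 : G → R) ∉ P := by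
    by_contra! hne
    refine hP.ne_top (P.eq_top_iff_one.2 ?_)
    rw [show (1 : G → R) = ∑ h, Pi.single h 1 from (Finset.univ_sum_single 1).symm]
    exact Submodule.sum_mem _ fun h _ => hne h
  have hother : ∀ h' ≠ h, (Pi.single h' 1 : G → R) ∈ P := by
    intro h' hne
    refine (hP.mem_or_mem (y := Pi.single h 1) ?_).resolve_right hh
    have h0 : (Pi.single h' 1 * Pi.single h 1 : G → R) = 0 := by
      ext x
      simp only [Pi.mul_apply, Pi.single_apply, Pi.zero_apply]
      split_ifs with h1 h2 <;> simp
      exact absurd (h1.symm.trans h2) hne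
    rw [h0]
    exact zero_mem _
  refine hh (hcomap ▸ ?_)
  have : translation (k := k) G R g⁻¹ (Pi.single h 1) = Pi.single (g⁻¹ * h) 1 := by
    ext x
    rw [translation_apply, inv_inv, Pi.single_apply, Pi.single_apply]
    simp only [eq_inv_mul_iff_mul_eq]
  rw [Ideal.mem_comap, this]
  refine hother _ fun h1 => hg ?_
  simpa using h1

variable {G} in
/-- The invariant functions on a spectrum. -/
def invariantsEquiv {R : Type u} [CommRing R] [Algebra k R] (σ : G →* (R →ₐ[k] R)) :
    invariants σ ≃+* invariantFunctions (specAction σ) :=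
  RingEquiv.ofBijective
    (((specFunctions σ : R →+* _).comp (invariants σ).subtype).codRestrict
      (invariantFunctions (specAction σ)) fun r => mem_invariantFunctions_iff.2 fun g =>
        (functionAction_specFunctions σ g r).trans (congrArg _ (r.2 g))) (by
    constructor
    · intro r s h
      exact Subtype.ext ((specFunctions σ).injective (congrArg Subtype.val h))
    · intro s
      obtain ⟨f, hf⟩ := (specFunctions σ).surjective s.1
      refine ⟨⟨f, fun g => (specFunctions σ).injective ?_⟩, Subtype.ext hf⟩
      rw [← functionAction_specFunctions, hf]
      exact mem_invariantFunctions_iff.1 s.2 g)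

/-- The translation-invariant functions are the constant ones. -/
def constantsEquiv (R : Type u) [CommRing R] [Algebra k R] :
    R ≃+* invariants (translation (k := k) G R) :=
  RingEquiv.ofBijective
    ((Pi.constRingHom G R).codRestrict (invariants (translation (k := k) G R)) fun _ _ => rfl) (by
    constructor
    · intro r s h
      exact congrFun (congrArg Subtype.val h) 1
    · intro f
      refine ⟨f.1 1, Subtype.ext (funext fun h => ?_)⟩
      have h1 := congrFun (f.2 h) h
      rw [translation_apply, inv_mul_cancel] at h1
      exact h1)

/-- The algebra is isomorphic to the invariant functions on its trivial torsor. -/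
def torsorEquiv (R : Type u) [CommRing R] [Algebra k R] :
    R ≃+* invariantFunctions (specAction (translation (k := k) G R)) :=
  (constantsEquiv G R).trans (invariantsEquiv _)

lemma torsorEquiv_algebraMap (R : Type u) [CommRing R] [Algebra k R] (c : k) :
    (torsorEquiv (k := k) G R (algebraMap k R c)).1
      = (constants (specAction (translation (k := k) G R)).V).hom c :=
  (specFunctions (translation (k := k) G R)).commutes c

/-- The quotient of the trivial torsor over a spectrum. -/
def quotientTranslationIso (R : Type u) [CommRing R] [Algebra k R] :
    quotient (specAction (translation (k := k) G R))
      ≅ Over.mk (Spec.map (CommRingCat.ofHom (algebraMap k R))) :=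
  Over.isoMk (Scheme.Spec.mapIso (torsorEquiv (k := k) G R).toCommRingCatIso.op) (by
    have h : CommRingCat.ofHom (algebraMap k R) ≫
        CommRingCat.ofHom (torsorEquiv (k := k) G R : R →+* _)
        = CommRingCat.ofHom ((constants (specAction (translation (k := k) G R)).V).hom.codRestrict
          (invariantFunctions _) (constants_mem _)) := by
      ext c
      exact torsorEquiv_algebraMap G R c
    exact (Spec.map_comp _ _).symm.trans (congrArg Spec.map h))

variable (X : Over (Spec (CommRingCat.of k)))

lemma toSpecΓ_comp_constants :
    X.left.toSpecΓ ≫ Spec.map (constants X) = X.hom := by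
  rw [constants, Spec.map_comp, ← Scheme.toSpecΓ_naturality_assoc]
  simp

/-- An affine scheme over `k` is the spectrum of its algebra of functions. -/
def isoSpecFunctions [IsAffine X.left] :
    Over.mk (Spec.map (CommRingCat.ofHom (algebraMap k Γ(X.left, ⊤)))) ≅ X :=
  (Over.isoMk X.left.isoSpec (toSpecΓ_comp_constants X)).symm

variable {X}

lemma IsAffineVariety.trivialTorsor [Finite G] (hX : IsAffineVariety X) :
    IsAffineVariety (specAction (translation (k := k) G Γ(X.left, ⊤))).V := by
  have := hX.affine
  have := hX.reduced
  have hfin := hX.finiteType_functions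
  have hred : _root_.IsReduced (G → Γ(X.left, ⊤)) := by
    refine ⟨fun f ⟨n, hf⟩ => funext fun g => ?_⟩
    exact IsReduced.eq_zero (f g) ⟨n, congrFun hf g⟩
  refine ⟨?_, ?_, ?_⟩
  · exact inferInstanceAs (IsAffine (Spec (CommRingCat.of (G → Γ(X.left, ⊤)))))
  · have : _root_.IsReduced (CommRingCat.of (G → Γ(X.left, ⊤))) := hred
    exact inferInstanceAs (IsReduced (Spec (CommRingCat.of (G → Γ(X.left, ⊤)))))
  · have : IsScalarTower k Γ(X.left, ⊤) (G → Γ(X.left, ⊤)) :=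
      IsScalarTower.of_algebraMap_eq fun _ => rfl
    have h1 : Algebra.FiniteType k (G → Γ(X.left, ⊤)) :=
      Algebra.FiniteType.trans hfin (Module.Finite.finiteType _)
    exact (HasRingHomProperty.Spec_iff (P := @LocallyOfFiniteType)).2
      ((RingHom.finiteType_algebraMap).2 h1)

lemma IsAffineVariety.exists_free_quotient_iso [Finite G] (hX : IsAffineVariety X) :
    ∃ Y : Action (Over (Spec (CommRingCat.of k))) G,
      IsAffineVariety Y.V ∧ IsFree Y ∧ Nonempty (quotient Y ≅ X) := by
  have := hX.affine
  exact ⟨_, hX.trivialTorsor G, isFree_translation G _,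
    ⟨quotientTranslationIso G _ ≪≫ isoSpecFunctions X⟩⟩

end TrivialTorsor

/-! ### Torsors compared with the spectrum of a trace-surjective algebra. -/

section Torsors

variable {k : Type u} [Field k] {G : Type u} [Group G] [Fintype G]

attribute [local instance] functionsAlgebra

variable {R : Type u} [CommRing R] [Algebra k R] {σ : G →* (R →ₐ[k] R)}
  {Y : Action (Over (Spec (CommRingCat.of k))) G} {X : Over (Spec (CommRingCat.of k))}
  {p n : ℕ} [Fact p.Prime] [CharP k p]

lemma exists_isPullback_quotientMap (hG : Fintype.card G = p ^ n) (hσ : IsTraceSurjective σ)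
    [IsAffine Y.V.left] {φ : R →ₐ[k] Γ(Y.V.left, ⊤)} (hφ : IsEquivariant σ (functionAction Y) φ)
    (e : quotient Y ≅ X) :
    ∃ (f : X ⟶ quotient (specAction σ)) (ψ : Y ⟶ specAction σ),
      IsPullback (quotientMap Y ≫ e.hom) ψ.hom f (quotientMap (specAction σ)) := by
  obtain ⟨u, hu⟩ := isTraceSurjective_iff.1 hσ
  have : IsAffine (specAction σ).V.left := inferInstanceAs (IsAffine (Spec (CommRingCat.of R)))
  have hpb := isPullback_mapQuotient hG (toSpecAction φ hφ) (specFunctions_trace σ hu)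
  exact ⟨e.inv ≫ mapQuotient (toSpecAction φ hφ), toSpecAction φ hφ,
    hpb.of_iso (Iso.refl _) e (Iso.refl _) (Iso.refl _) (by simp) (by simp) (by simp) (by simp)⟩

lemma exists_isClosedImmersion_pow (hG : Fintype.card G = p ^ n) {m : ℕ} (hm : m ≠ 0)
    (hσ : IsTraceSurjective σ) (ht : IsTriangular m σ) (hY : IsAffineVariety Y.V)
    {φ : R →ₐ[k] Γ(Y.V.left, ⊤)} (hφ : IsEquivariant σ (functionAction Y) φ) :
    ∃ (N : ℕ) (ι : Y ⟶ ∏ᶜ fun _ : Fin N => specAction σ), IsClosedImmersion ι.hom.left := by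
  have := hY.affine
  have := hY.finiteType_functions
  have : IsAffine (specAction σ).V.left := inferInstanceAs (IsAffine (Spec (CommRingCat.of R)))
  obtain ⟨N, Φ, hΦ, htop⟩ := exists_equivariant_generators hG hm ht hσ hφ
  refine ⟨N, Pi.lift fun i => toSpecAction (Φ i) (hΦ i), ?_⟩
  refine isClosedImmersion_of_iSup_range_eq_top
    (fun i => (Pi.π (fun _ : Fin N => specAction σ) i).hom)
    (prod_hom_ext fun _ : Fin N => specAction σ) _ ?_
  rw [eq_top_iff, ← htop]
  refine iSup_mono fun i => ?_
  rintro _ ⟨r, rfl⟩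
  have h1 : (Pi.lift fun i => toSpecAction (Φ i) (hΦ i)).hom ≫
      (Pi.π (fun _ : Fin N => specAction σ) i).hom = (toSpecAction (Φ i) (hΦ i)).hom := by
    rw [← Action.comp_hom, Pi.lift_π]
  rw [h1]
  exact ⟨specFunctions _ r, pullbackFunctions_toSpecAction (Φ i) (hΦ i) r⟩

end Torsors

end FreeAction

end

open FreeAction in
theorem theorem0p3 {k : Type u} [Field k] [IsAlgClosed k] (p : ℕ) [Fact p.Prime] [CharP k p]
    (G : Type u) [Group G] [Fintype G] (n : ℕ) (hG : Fintype.card G = p ^ n) :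
    (∃ U : Subalgebra k (Dehom k G), IsStandard n U) ∧
    ∀ X : Over (Spec (CommRingCat.of k)), IsAffineVariety X →
      -- existence of `Y`
      (∃ Y : Action (Over (Spec (CommRingCat.of k))) G,
        IsAffineVariety Y.V ∧ IsFree Y ∧ Nonempty (quotient Y ≅ X)) ∧
      ∀ (U : Subalgebra k (Dehom k G)) (hU : IsStandard n U)
        (Y : Action (Over (Spec (CommRingCat.of k))) G),
        IsAffineVariety Y.V → IsFree Y → ∀ e : quotient Y ≅ X,
          -- `Y` is the fibre product of `X` and `B` over `B/G`
          (∃ (φ : X ⟶ quotient (varietyB hU)) (ψ : Y ⟶ varietyB hU),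
            IsPullback (quotientMap Y ≫ e.hom) ψ.hom φ (quotientMap (varietyB hU))) ∧
          -- `Y` embeds equivariantly into a power of `B`
          (Nontrivial G → ∃ (N : ℕ) (ι : Y ⟶ ∏ᶜ fun _ : Fin N => varietyB hU),
            IsClosedImmersion ι.hom.left) := by
  refine ⟨(nonempty_standardModel (p := p) n G hG).elim fun M => M.exists_isStandard,
    fun X hX => ⟨hX.exists_free_quotient_iso G, ?_⟩⟩
  intro U hU Y hY hfree e
  let _ := functionsAlgebra Y.V
  have := hY.affine
  obtain ⟨a, ha⟩ := hfree.exists_trace_eq_one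
  -- Freeness gives a function a of trace 1; U maps to k[Y] by restricting X_g ↦ g(a) from D.
  have hφ : IsEquivariant (restrictAction (dehomAction k G) U hU.stable) (functionAction Y)
      ((dehomLift _ ha).comp U.val) :=
    fun g r => isEquivariant_dehomLift (functionAction Y) ha g r
  refine ⟨exists_isPullback_quotientMap hG hU.traceSurjective hφ e, fun _ => ?_⟩
  -- The embedding translates the last variable of U, so at least one variable must exist; this is
  -- where G ≠ 1 enters.
  have hn : n ≠ 0 := by
    rintro rfl
    have := Fintype.one_lt_card (α := G)
    rw [hG, pow_zero] at this
    exact lt_irrefl _ this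
  exact exists_isClosedImmersion_pow hG hn hU.traceSurjective hU.triangular hY hφ
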